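/- Let $n\ge 0$ be an integer. For $k,l\in\mathbb Z^n$ let $T^t_{(k,l)}$ be the twisted translation on $L^2(\mathbb R^{2n})$, $$T^t_{(k,l)}f(x,y)=e^{\pi i(x\cdot l-y\cdot k)}f(x-k,y-l),\qquad x,y\in\mathbb R^n.$$ For $f\in L^1\cap L^2(\mathbb R^{2n})$ let $K_f(\xi,\eta)=\int_{\mathbb R^n}f(x,\eta-\xi)e^{\pi i x\cdot(\xi+\eta)}\,dx$ be the kernel of its Weyl transform, and extend $f\mapsto K_f$ by continuity to an isometry of $L^2(\mathbb R^{2n})$. The Weyl–Zak transform of $f\in L^2(\mathbb R^{2n})$ is $$Z_Wf(\xi,\xi',\eta)=\sum_{m\in\mathbb Z^n}K_f(m+\xi,\eta)e^{-2\pi i m\cdot\xi'}\quad\text{in } L^2(\mathbb T^n\times\mathbb T^n\times\mathbb R^n),$$ where $\mathbb T^n=(\mathbb R/\mathbb Z)^n$ is identified with a unit cube, and $\mathcal J f(\xi,\xi')=Z_Wf(\xi,\xi',\cdot)\in L^2(\mathbb R^n)$ for a.e. $(\xi,\xi')\in\mathbb T^n\times\mathbb T^n$. Let $V\subset L^2(\mathbb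 R^{2n})$ be a twisted shift-invariant space, i.e. a closed subspace with $T^t_{(k,l)}V\subset V$ for all $k,l\in\mathbb Z^n$. Let $J$ be its range function: closed subspaces $J(\xi,\xi')$ of $L^2(\mathbb R^n)$ with $J(\xi,\xi')=\overline{\operatorname{span}}\{\mathcal J f_i(\xi,\xi'):i\in\mathbb N\}$ for a.e. $(\xi,\xi')$, where $(f_i)_{i\in\mathbb N}$ is a dense sequence in $V$ (up to null sets, $J$ does not depend on that sequence). Let $U:V\to V$ be a bounded linear operator that is twisted shift preserving, i.e. $UT^t_{(k,l)}=T^t_{(k,l)}U$ on $V$ for all $k,l\in\mathbb Z^n$, and let $R$ be a range operator corresponding to $U$, i.e. bounded linear operators $R(\xi,\xi'):J(\xi,\xi')\to L^2(\mathbb R^n)$ such that $(\xi,\xi')\mapsto\langle R(\xi,\xi')P(\xi,\xi')a,b\rangle$ is Lebesgue measurable for all $a,b\in L^2(\mathbb R^n)$, where $P(\xi,\xi')$ is the orthogonal projection onto $J(\xi,\xi')$, and such that for every $f\in V$ $$\mathcal J(Uf)(\xi,\xi')=R(\xi,\xi')\bigl(\mathcal J f(\xi,\xi')\bigr)\quad\text{for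 a.e. }(\xi,\xi').$$ Then $R(\xi,\xi')$ maps $J(\xi,\xi')$ into itself for a.e. $(\xi,\xi')$, and, regarding it as an operator on $J(\xi,\xi')$: (i) The adjoint $U^*:V\to V$ is twisted shift preserving, and $(\xi,\xi')\mapsto R(\xi,\xi')^*$ is a range operator corresponding to $U^*$. (ii) For all real $A\le B$: $U$ is self-adjoint with $\sigma(U)\subset[A,B]$ if and only if, for a.e. $(\xi,\xi')$, $R(\xi,\xi')$ is self-adjoint with $\sigma(R(\xi,\xi'))\subset[A,B]$. (iii) $U$ is unitary if and only if $R(\xi,\xi')$ is unitary for a.e. $(\xi,\xi')$. -/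

import Mathlib

open MeasureTheory
open scoped FourierTransform ENNReal

lemma eLpNorm_fourier_two {n : ℕ} {g : EuclideanSpace ℝ (Fin n) → ℂ} (h1 : Integrable g)
    (h2 : MemLp g 2) : eLpNorm (𝓕 g) 2 = eLpNorm g 2 := by
  set G : Lp ℂ 2 (volume : Measure (EuclideanSpace ℝ (Fin n))) := h2.toLp g with hG
  set H : Lp ℂ 2 (volume : Measure (EuclideanSpace ℝ (Fin n))) := 𝓕 G with hH
  have key : (𝓕 g) =ᵐ[volume] ⇑H := by
    have hc : Continuous (𝓕 g) :=
      VectorFourier.fourierIntegral_continuous Real.continuous_fourierChar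
        (innerSL ℝ).continuous₂ h1
    have hloc : LocallyIntegrable (⇑H) volume :=
      (Lp.memLp H).locallyIntegrable (by norm_num)
    refine ae_eq_of_integral_contDiff_smul_eq hc.locallyIntegrable hloc ?_
    intro φ hφ hφc
    have hφ' : ContDiff ℝ (⊤ : ℕ∞) (fun x => (φ x : ℂ)) :=
      Complex.ofRealCLM.contDiff.comp hφ
    have hφc' : HasCompactSupport (fun x => (φ x : ℂ)) :=
      hφc.comp_left (g := fun r : ℝ => (r : ℂ)) (by simp)
    set Φ : SchwartzMap (EuclideanSpace ℝ (Fin n)) ℂ := hφc'.toSchwartzMap hφ' with hΦ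
    have e1 := congrArg (fun T => T Φ) (Lp.fourier_toTemperedDistribution_eq G)
    simp only [TemperedDistribution.fourier_apply, Lp.toTemperedDistribution_apply] at e1
    have e2 : ∫ x, (𝓕 Φ) x • G x = ∫ x, (𝓕 Φ) x • g x := by
      refine integral_congr_ae ?_
      filter_upwards [h2.coeFn_toLp] with x hx
      rw [hG, hx]
    have e3 : ∫ x, (𝓕 Φ) x • g x = ∫ x, Φ x • (𝓕 g) x := by
      have := VectorFourier.integral_fourierIntegral_smul_eq_flip (L := innerₗ (EuclideanSpace ℝ (Fin n)))
        (μ := volume) (ν := volume) Real.continuous_fourierChar continuous_inner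
        Φ.integrable h1
      rw [flip_innerₗ] at this
      exact this
    have e4 : ∀ F : EuclideanSpace ℝ (Fin n) → ℂ, ∫ x, φ x • F x = ∫ x, Φ x • F x := by
      intro F
      rfl
    rw [e4, e4, ← e3, ← e2, e1]
  rw [eLpNorm_congr_ae key, ← eLpNorm_congr_ae h2.coeFn_toLp]
  have := Lp.norm_fourier_eq G
  rw [Lp.norm_def, Lp.norm_def] at this
  exact (ENNReal.toReal_eq_toReal_iff' (Lp.eLpNorm_ne_top _) (Lp.eLpNorm_ne_top _)).1 this

lemma eLpNorm_fourierInv_two {n : ℕ} {g : EuclideanSpace ℝ (Fin n) → ℂ} (h1 : Integrable g)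
    (h2 : MemLp g 2) : eLpNorm (𝓕⁻ g) 2 = eLpNorm g 2 := by
  have hmp := Measure.measurePreserving_neg (volume : Measure (EuclideanSpace ℝ (Fin n)))
  rw [Real.fourierInv_eq_fourier_comp_neg]
  refine (eLpNorm_fourier_two (hmp.integrable_comp_of_integrable h1)
    (h2.comp_measurePreserving hmp)).trans ?_
  exact eLpNorm_comp_measurePreserving h2.1 hmp

/-- The Euclidean space `ℝⁿ`. -/
abbrev EucSp (n : ℕ) : Type := EuclideanSpace ℝ (Fin n)

/-- The Hilbert space `L²(ℝ²ⁿ)`, with points of `ℝ²ⁿ` written `(x, y)`, `x, y ∈ ℝⁿ`. -/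
abbrev L2Phase (n : ℕ) : Type := Lp ℂ 2 (volume : Measure (EucSp n × EucSp n))

/-- The kernel of the Weyl transform of an integrable function `f` on `ℝ²ⁿ`:
`K_f(ξ, η) = ∫ f(x, η - ξ) exp(π i x·(ξ + η)) dx`, with `z = (ξ, η)`. -/
noncomputable def weylKernelIntegral (n : ℕ) (f : EucSp n × EucSp n → ℂ) (z : EucSp n × EucSp n) : ℂ :=
  ∫ x : EucSp n, f (x, z.2 - z.1) * Complex.exp (Real.pi * Complex.I * (inner ℝ x (z.1 + z.2) : ℝ))

lemma measurePreserving_weyl (n : ℕ) :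
    MeasurePreserving (fun z : EucSp n × EucSp n => ((2⁻¹ : ℝ) • (z.1 + z.2), z.2 - z.1)) := by
  have h1 : MeasurePreserving (fun z : EucSp n × EucSp n => (z.1, z.2 - z.1)) :=
    (MeasurePreserving.id volume).skew_product (g := fun ξ η => η - ξ)
      (by fun_prop) (.of_forall fun ξ => (measurePreserving_sub_right volume ξ).map_eq)
  have h2 : MeasurePreserving (fun z : EucSp n × EucSp n => (z.1, z.2 + (2⁻¹ : ℝ) • z.1)) :=
    (MeasurePreserving.id volume).skew_product (g := fun y ξ => ξ + (2⁻¹ : ℝ) • y)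
      (by fun_prop) (.of_forall fun y => (measurePreserving_add_right volume _).map_eq)
  have hs : MeasurePreserving (Prod.swap : EucSp n × EucSp n → _) := Measure.measurePreserving_swap
  convert hs.comp (h2.comp (hs.comp h1)) using 1
  ext1 z
  refine Prod.ext ?_ rfl
  simp only [Function.comp_apply, Prod.swap]
  module

lemma weylKernelIntegral_eq (n : ℕ) (f : EucSp n × EucSp n → ℂ) (z : EucSp n × EucSp n) :
    weylKernelIntegral n f z = 𝓕⁻ (fun x => f (x, z.2 - z.1)) ((2⁻¹ : ℝ) • (z.1 + z.2)) := by
  rw [Real.fourierInv_eq', weylKernelIntegral]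
  refine integral_congr_ae (.of_forall fun x => ?_)
  simp only [inner_smul_right, smul_eq_mul]
  rw [mul_comm]
  congr 2
  push_cast
  ring

lemma eLpNorm_prod_two {n : ℕ} {F : EucSp n × EucSp n → ℂ} (hF : AEStronglyMeasurable F) :
    eLpNorm F 2 ^ (2 : ℝ) = ∫⁻ y, eLpNorm (fun x => F (x, y)) 2 ^ (2 : ℝ) := by
  have h : ∀ {α : Type} [MeasureSpace α] (G : α → ℂ),
      eLpNorm G 2 ^ (2 : ℝ) = ∫⁻ x, ‖G x‖ₑ ^ (2 : ℝ) := by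
    intro α _ G
    rw [eLpNorm_eq_lintegral_rpow_enorm_toReal two_ne_zero ENNReal.ofNat_ne_top, ← ENNReal.rpow_mul]
    simp
  simp_rw [h]
  rw [Measure.volume_eq_prod, lintegral_prod_symm]
  exact hF.enorm.pow_const _

lemma eLpNorm_weylKernelIntegral (n : ℕ) {f : EucSp n × EucSp n → ℂ} (hm : StronglyMeasurable f)
    (h1 : Integrable f) (h2 : MemLp f 2) :
    AEStronglyMeasurable (weylKernelIntegral n f) ∧ eLpNorm (weylKernelIntegral n f) 2 = eLpNorm f 2 := by
  set G : EucSp n × EucSp n → ℂ := fun w => 𝓕⁻ (fun x => f (x, w.2)) w.1 with hG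
  have hGm : StronglyMeasurable G := by
    simp only [hG, Real.fourierInv_eq']
    refine StronglyMeasurable.integral_prod_right
      (f := fun w : EucSp n × EucSp n => fun x : EucSp n =>
        Complex.exp ((2 * Real.pi * (inner ℝ x w.1 : ℝ) : ℝ) * Complex.I) • f (x, w.2)) ?_
    have c1 : Continuous (fun q : (EucSp n × EucSp n) × EucSp n =>
        Complex.exp ((2 * Real.pi * (inner ℝ q.2 q.1.1 : ℝ) : ℝ) * Complex.I)) := by fun_prop
    have c2 : StronglyMeasurable (fun q : (EucSp n × EucSp n) × EucSp n => f (q.2, q.1.2)) :=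
      hm.comp_measurable (by fun_prop)
    exact c1.stronglyMeasurable.smul c2
  have hK : weylKernelIntegral n f = G ∘ fun z => ((2⁻¹ : ℝ) • (z.1 + z.2), z.2 - z.1) := by
    ext z
    exact weylKernelIntegral_eq n f z
  have hmp := measurePreserving_weyl n
  refine ⟨?_, ?_⟩
  · rw [hK]
    exact hGm.aestronglyMeasurable.comp_measurePreserving hmp
  · rw [hK, eLpNorm_comp_measurePreserving hGm.aestronglyMeasurable hmp]
    have : eLpNorm G 2 ^ (2 : ℝ) = eLpNorm f 2 ^ (2 : ℝ) := by
      rw [eLpNorm_prod_two hGm.aestronglyMeasurable, eLpNorm_prod_two h2.1]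
      refine lintegral_congr_ae ?_
      have a1 : ∀ᵐ y : EucSp n, Integrable (fun x => f (x, y)) := by
        rw [Measure.volume_eq_prod] at h1
        exact h1.prod_left_ae
      have a2 : ∀ᵐ y : EucSp n, eLpNorm (fun x => f (x, y)) 2 ^ (2 : ℝ) < ∞ := by
        refine ae_lt_top' ?_ ?_
        · have : ∀ y : EucSp n, eLpNorm (fun x => f (x, y)) 2 ^ (2 : ℝ)
              = ∫⁻ x, ‖f (x, y)‖ₑ ^ (2 : ℝ) := by
            intro y
            rw [eLpNorm_eq_lintegral_rpow_enorm_toReal two_ne_zero ENNReal.ofNat_ne_top,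
              ← ENNReal.rpow_mul]
            simp
          simp_rw [this]
          exact ((hm.enorm.pow_const (2 : ℝ)).lintegral_prod_left').aemeasurable
        · rw [← eLpNorm_prod_two h2.1]
          exact ENNReal.rpow_ne_top_of_nonneg (by norm_num) h2.2.ne
      filter_upwards [a1, a2] with y hy1 hy2
      have hy3 : MemLp (fun x => f (x, y)) 2 :=
        ⟨hy1.1, by
          by_contra hcon
          rw [not_lt, top_le_iff] at hcon
          rw [hcon] at hy2
          simp at hy2⟩
      have := eLpNorm_fourierInv_two hy1 hy3
      simp only [hG]
      rw [← this]
    exact (ENNReal.rpow_left_injective (by norm_num : (2 : ℝ) ≠ 0)) this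

/-- The dense subspace `L¹ ∩ L²` of `L²(ℝ²ⁿ)`. -/
def l1l2 (n : ℕ) : Submodule ℂ (L2Phase n) where
  carrier := {f : L2Phase n | Integrable f}
  zero_mem' := by
    have h : Integrable (0 : EucSp n × EucSp n → ℂ) := integrable_zero _ _ _
    exact h.congr (Lp.coeFn_zero ℂ 2 (volume : Measure (EucSp n × EucSp n))).symm
  add_mem' {f g} hf hg := by
    have hf' : Integrable f := hf
    have hg' : Integrable g := hg
    exact (hf'.add hg').congr (Lp.coeFn_add f g).symm
  smul_mem' c f hf := by
    have hf' : Integrable f := hf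
    exact (hf'.smul c).congr (Lp.coeFn_smul c f).symm

lemma memLp_weylKernelIntegral {n : ℕ} (f : l1l2 n) : MemLp (weylKernelIntegral n (f : L2Phase n)) 2 := by
  obtain ⟨h, h'⟩ := eLpNorm_weylKernelIntegral n (Lp.stronglyMeasurable (f : L2Phase n)) f.2 (Lp.memLp _)
  exact ⟨h, h' ▸ Lp.eLpNorm_lt_top _⟩

lemma weylKernelIntegral_congr {n : ℕ} {f g : EucSp n × EucSp n → ℂ} (h : f =ᵐ[volume] g) :
    weylKernelIntegral n f =ᵐ[volume] weylKernelIntegral n g := by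
  have h1 : ∀ᵐ y : EucSp n, ∀ᵐ x : EucSp n, f (x, y) = g (x, y) := by
    rw [Measure.volume_eq_prod] at h
    exact Measure.ae_ae_of_ae_prod (Measure.measurePreserving_swap.quasiMeasurePreserving.ae h)
  have h2 : ∀ᵐ z : EucSp n × EucSp n, ∀ᵐ x : EucSp n, f (x, z.2 - z.1) = g (x, z.2 - z.1) := by
    have h3 : ∀ᵐ w : EucSp n × EucSp n, ∀ᵐ x : EucSp n, f (x, w.2) = g (x, w.2) :=
      Measure.quasiMeasurePreserving_snd.ae h1
    exact (measurePreserving_weyl n).quasiMeasurePreserving.ae h3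
  filter_upwards [h2] with z hz
  refine integral_congr_ae ?_
  filter_upwards [hz] with x hx
  rw [hx]

lemma ae_integrable_weyl {n : ℕ} {f : EucSp n × EucSp n → ℂ} (h : Integrable f) :
    ∀ᵐ z : EucSp n × EucSp n, Integrable fun x : EucSp n =>
      f (x, z.2 - z.1) * Complex.exp (Real.pi * Complex.I * (inner ℝ x (z.1 + z.2) : ℝ)) := by
  have h1 : ∀ᵐ y : EucSp n, Integrable fun x : EucSp n => f (x, y) := by
    rw [Measure.volume_eq_prod] at h
    exact h.prod_left_ae
  have h3 : ∀ᵐ w : EucSp n × EucSp n, Integrable fun x : EucSp n => f (x, w.2) :=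
    Measure.quasiMeasurePreserving_snd.ae h1
  filter_upwards [(measurePreserving_weyl n).quasiMeasurePreserving.ae h3] with z hz
  refine hz.mul_bdd (c := 1) ?_ (.of_forall fun x => ?_)
  · exact Continuous.aestronglyMeasurable (by fun_prop)
  · rw [show (Real.pi * Complex.I * (inner ℝ x (z.1 + z.2) : ℝ) : ℂ)
      = ((Real.pi * inner ℝ x (z.1 + z.2) : ℝ) : ℂ) * Complex.I by push_cast; ring,
      Complex.norm_exp_ofReal_mul_I]

/-- `f ↦ K_f` on `L¹ ∩ L²`. -/
noncomputable def weylKernelL1L2 (n : ℕ) : l1l2 n →ₗ[ℂ] L2Phase n where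
  toFun f := (memLp_weylKernelIntegral f).toLp _
  map_add' f g := by
    rw [← MemLp.toLp_add]
    refine MemLp.toLp_congr _ _ ?_
    refine (weylKernelIntegral_congr (Lp.coeFn_add (f : L2Phase n) (g : L2Phase n))).trans ?_
    filter_upwards [ae_integrable_weyl f.2, ae_integrable_weyl g.2] with z hf hg
    simp only [weylKernelIntegral, Pi.add_apply, add_mul]
    exact integral_add hf hg
  map_smul' c f := by
    rw [RingHom.id_apply, ← MemLp.toLp_const_smul]
    refine MemLp.toLp_congr _ _ ?_
    refine (weylKernelIntegral_congr (Lp.coeFn_smul c (f : L2Phase n))).trans (.of_forall fun z => ?_)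
    simp only [weylKernelIntegral, Pi.smul_apply, smul_eq_mul, mul_assoc]
    exact integral_const_mul _ _

lemma norm_weylKernelL1L2 {n : ℕ} (f : l1l2 n) : ‖weylKernelL1L2 n f‖ = ‖(l1l2 n).subtype f‖ := by
  obtain ⟨h, h'⟩ := eLpNorm_weylKernelIntegral n (Lp.stronglyMeasurable (f : L2Phase n)) f.2 (Lp.memLp _)
  change ‖(memLp_weylKernelIntegral f).toLp _‖ = ‖(f : L2Phase n)‖
  rw [Lp.norm_toLp, h', Lp.norm_def]

lemma dense_l1l2 (n : ℕ) : DenseRange (l1l2 n).subtype := by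
  refine Metric.dense_iff.2 fun f ε hε => ?_
  obtain ⟨g, hgc, hge, hgcont, hgm⟩ := (Lp.memLp f).exists_hasCompactSupport_eLpNorm_sub_le
    ENNReal.ofNat_ne_top (ε := ENNReal.ofReal (ε / 2)) (by simpa using hε)
  refine ⟨hgm.toLp g, ?_, ⟨⟨hgm.toLp g, ?_⟩, rfl⟩⟩
  · rw [Metric.mem_ball, dist_comm, Lp.dist_def]
    have : eLpNorm (⇑f - ⇑(hgm.toLp g)) 2 volume = eLpNorm (⇑f - g) 2 volume :=
      eLpNorm_congr_ae (.sub .rfl hgm.coeFn_toLp)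
    rw [this]
    refine (ENNReal.toReal_mono ENNReal.ofReal_ne_top hge).trans_lt ?_
    rw [ENNReal.toReal_ofReal (by positivity)]
    linarith
  · exact (hgcont.integrable_of_hasCompactSupport hgc).congr hgm.coeFn_toLp.symm

/-- The kernel `K_f` of the Weyl transform for all `f ∈ L²(ℝ²ⁿ)`: the continuous extension of
`f ↦ K_f` from `L¹ ∩ L²`; it is isometric by `norm_weylKernel`. -/
noncomputable def weylKernel (n : ℕ) : L2Phase n →L[ℂ] L2Phase n :=
  (weylKernelL1L2 n).extendOfNorm (l1l2 n).subtype

lemma weylKernel_eq {n : ℕ} (f : l1l2 n) :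
    weylKernel n f = (memLp_weylKernelIntegral f).toLp _ :=
  LinearMap.extendOfNorm_eq (dense_l1l2 n)
    ⟨1, fun x => by rw [one_mul]; exact (norm_weylKernelL1L2 x).le⟩ f

lemma norm_weylKernel {n : ℕ} (f : L2Phase n) : ‖weylKernel n f‖ = ‖f‖ := by
  refine (dense_l1l2 n).induction_on (p := fun f => ‖weylKernel n f‖ = ‖f‖) f
    (isClosed_eq (by fun_prop) (by fun_prop)) fun g => ?_
  exact (congrArg norm (weylKernel_eq g)).trans (norm_weylKernelL1L2 g)

/-- The lattice point of `ℤⁿ` as a vector of `ℝⁿ`. -/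
noncomputable def latticeVec {n : ℕ} (k : Fin n → ℤ) : EucSp n :=
  WithLp.toLp 2 fun i => (k i : ℝ)

/-- The torus `𝕋ⁿ = (ℝ/ℤ)ⁿ`. -/
abbrev Torus (n : ℕ) : Type := UnitAddTorus (Fin n)

/-- The normalised Haar (Lebesgue) measure on `𝕋ⁿ`. -/
noncomputable def torusMeasure (n : ℕ) : Measure (Torus n) :=
  Measure.pi fun _ => AddCircle.haarAddCircle

instance (n : ℕ) : IsProbabilityMeasure (torusMeasure n) := by
  unfold torusMeasure; infer_instance

/-- The normalised Haar measure on `𝕋ⁿ × 𝕋ⁿ`. -/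
noncomputable abbrev torusMeasure₂ (n : ℕ) : Measure (Torus n × Torus n) :=
  (torusMeasure n).prod (torusMeasure n)

/-- The representative in the unit cube `(0, 1]ⁿ` of a point of `𝕋ⁿ`. -/
noncomputable def torusRep {n : ℕ} (ξ : Torus n) : EucSp n :=
  WithLp.toLp 2 fun i => (AddCircle.equivIoc 1 0 (ξ i) : ℝ)

lemma map_torusRep_le (n : ℕ) (v : EucSp n) :
    Measurable (fun ξ : Torus n => torusRep ξ + v) ∧
    (torusMeasure n).map (fun ξ : Torus n => torusRep ξ + v) ≤ volume := by
  have hS : MeasurableSet {x : Fin n → ℝ | ∀ i, x i ∈ Set.Ioc ((0 : Fin n → ℝ) i) ((0 : Fin n → ℝ) i + 1)} :=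
    MeasurableSet.univ_pi' fun i => measurableSet_Ioc
  have h1 := UnitAddTorus.measurePreserving_equivPiIoc (0 : Fin n → ℝ)
  have h2 : MeasurePreserving (fun x : Fin n → ℝ => WithLp.toLp 2 x + v) volume volume :=
    (measurePreserving_add_right volume v).comp (PiLp.volume_preserving_toLp (Fin n))
  have hm : Measurable (fun ξ : Torus n => ((UnitAddTorus.measurableEquivPiIoc (0 : Fin n → ℝ) ξ) : Fin n → ℝ)) :=
    measurable_subtype_coe.comp (MeasurableEquiv.measurable _)
  have heq : (fun ξ : Torus n => torusRep ξ + v) = (fun x : Fin n → ℝ => WithLp.toLp 2 x + v) ∘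
      fun ξ : Torus n => ((UnitAddTorus.measurableEquivPiIoc (0 : Fin n → ℝ) ξ) : Fin n → ℝ) := rfl
  refine ⟨heq ▸ h2.measurable.comp hm, ?_⟩
  rw [heq, ← Measure.map_map h2.measurable hm]
  have h3 : (torusMeasure n).map
      (fun ξ : Torus n => ((UnitAddTorus.measurableEquivPiIoc (0 : Fin n → ℝ) ξ) : Fin n → ℝ)) ≤ volume := by
    have : (torusMeasure n).map (UnitAddTorus.measurableEquivPiIoc (0 : Fin n → ℝ))
      = Measure.comap Subtype.val volume := h1.map_eq
    have h4 := Measure.map_map (μ := torusMeasure n) measurable_subtype_coe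
      (UnitAddTorus.measurableEquivPiIoc (0 : Fin n → ℝ)).measurable
    rw [this] at h4
    refine (le_of_eq h4.symm).trans ?_
    exact (map_comap_subtype_coe hS volume).le.trans Measure.restrict_le_self
  exact (Measure.map_mono h3 h2.measurable).trans h2.map_eq.le

/-- The term `K(m + ξ, η) exp(-2π i m·ξ')` of the Zak series, with `w = ((ξ, ξ'), η)`. -/
noncomputable def zakSummand {n : ℕ} (K : EucSp n × EucSp n → ℂ) (m : Fin n → ℤ)
    (w : (Torus n × Torus n) × EucSp n) : ℂ :=
  K (latticeVec m + torusRep w.1.1, w.2) * UnitAddTorus.mFourier (-m) w.1.2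

lemma memLp_zakSummand {n : ℕ} {K : EucSp n × EucSp n → ℂ} (hK : MemLp K 2) (m : Fin n → ℤ) :
    MemLp (zakSummand K m) 2 ((torusMeasure₂ n).prod volume) := by
  obtain ⟨hm, hle⟩ := map_torusRep_le n (latticeVec m)
  have hfst : MeasurePreserving (Prod.fst : Torus n × Torus n → Torus n) (torusMeasure₂ n) (torusMeasure n) :=
    measurePreserving_fst
  have hmp : MeasurePreserving
      (fun w : (Torus n × Torus n) × EucSp n => (latticeVec m + torusRep w.1.1, w.2))
      ((torusMeasure₂ n).prod volume)
      (((torusMeasure n).map (fun ξ : Torus n => torusRep ξ + latticeVec m)).prod volume) := by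
    have h := ((hm.measurePreserving (torusMeasure n)).comp hfst).prod (MeasurePreserving.id (volume : Measure (EucSp n)))
    convert h using 1
    ext1 w
    exact Prod.ext (add_comm _ _) rfl
  have hK' : MemLp K 2 (((torusMeasure n).map (fun ξ : Torus n => torusRep ξ + latticeVec m)).prod volume) := by
    refine hK.mono_measure ?_
    rw [Measure.volume_eq_prod]
    exact Measure.prod_mono hle le_rfl
  have hc := hK'.comp_measurePreserving hmp
  have he : Continuous fun w : (Torus n × Torus n) × EucSp n => UnitAddTorus.mFourier (-m) w.1.2 := by
    fun_prop
  refine hc.of_le (hc.1.mul he.aestronglyMeasurable) (.of_forall fun w => ?_)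
  rw [zakSummand, norm_mul]
  refine mul_le_of_le_one_right (norm_nonneg _) ?_
  exact ((UnitAddTorus.mFourier (-m)).norm_coe_le_norm w.1.2).trans UnitAddTorus.mFourier_norm.le

/-- The Weyl-Zak transform
`Z_W f(ξ, ξ', η) = ∑_{m ∈ ℤⁿ} K_f(m + ξ, η) exp(-2π i m·ξ')`. The terms are mutually orthogonal in
`L²(𝕋ⁿ × 𝕋ⁿ × ℝⁿ)` and their squared norms add up to `‖K_f‖²`, so the series converges
(unconditionally) in that space. -/
noncomputable def weylZak {n : ℕ} (f : L2Phase n) :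
    Lp ℂ 2 ((torusMeasure₂ n).prod (volume : Measure (EucSp n))) :=
  ∑' m : Fin n → ℤ, (memLp_zakSummand (Lp.memLp (weylKernel n f)) m).toLp _

/-- The Hilbert space `L²(ℝⁿ)`. -/
abbrev L2Fiber (n : ℕ) : Type := Lp ℂ 2 (volume : Measure (EucSp n))

open Classical in
/-- The map `𝒥`: for `p = (ξ, ξ')`, `𝒥 f (ξ, ξ') ∈ L²(ℝⁿ)` is the slice `η ↦ Z_W f(ξ, ξ', η)`.
By Fubini the slice is in `L²(ℝⁿ)` for almost every `p`; on the exceptional null set the value is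
set to `0`. -/
noncomputable def fiberMap {n : ℕ} (f : L2Phase n) (p : Torus n × Torus n) : L2Fiber n :=
  if h : MemLp (fun η : EucSp n => weylZak f (p, η)) 2 then h.toLp _ else 0

lemma measurePreserving_shift {n : ℕ} (v : EucSp n × EucSp n) : MeasurePreserving (fun z : EucSp n × EucSp n => (z.1 - v.1, z.2 - v.2)) :=
  (measurePreserving_sub_right volume v.1).prod (measurePreserving_sub_right volume v.2)

/-- `(x, y) ↦ exp(π i (x·l - y·k)) f(x - k, y - l)`, with `z = (x, y)`. -/
noncomputable def twistedTranslateFun {n : ℕ} (k l : Fin n → ℤ) (f : EucSp n × EucSp n → ℂ)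
    (z : EucSp n × EucSp n) : ℂ :=
  Complex.exp (Real.pi * Complex.I * (inner ℝ z.1 (latticeVec l) - inner ℝ z.2 (latticeVec k) : ℝ)) *
    f (z.1 - latticeVec k, z.2 - latticeVec l)

lemma memLp_twistedTranslateFun {n : ℕ} (k l : Fin n → ℤ) {f : EucSp n × EucSp n → ℂ} (hf : MemLp f 2) :
    MemLp (twistedTranslateFun k l f) 2 := by
  have hc := hf.comp_measurePreserving (measurePreserving_shift (latticeVec k, latticeVec l))
  have he : Continuous fun z : EucSp n × EucSp n =>
      Complex.exp (Real.pi * Complex.I * (inner ℝ z.1 (latticeVec l) - inner ℝ z.2 (latticeVec k) : ℝ)) := by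
    fun_prop
  refine hc.of_le (he.aestronglyMeasurable.mul hc.1) (.of_forall fun z => le_of_eq ?_)
  rw [twistedTranslateFun, norm_mul]
  have : ∀ t : ℝ, ‖Complex.exp (Real.pi * Complex.I * t)‖ = 1 := fun t => by
    rw [show (Real.pi * Complex.I * t : ℂ) = ((Real.pi * t : ℝ) : ℂ) * Complex.I by push_cast; ring,
      Complex.norm_exp_ofReal_mul_I]
  rw [this, one_mul]
  rfl

/-- The twisted translation `T^t_{(k,l)}` on `L²(ℝ²ⁿ)`. -/
noncomputable def twistedTranslate {n : ℕ} (k l : Fin n → ℤ) (f : L2Phase n) : L2Phase n :=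
  (memLp_twistedTranslateFun k l (Lp.memLp f)).toLp _

/-- Invariance under all twisted translations. The closedness of `V` that belongs to the notion of a
twisted shift-invariant space is expressed where it is used by `[CompleteSpace V]`. -/
def IsTwistedShiftInvariant {n : ℕ} (V : Submodule ℂ (L2Phase n)) : Prop :=
  ∀ k l : Fin n → ℤ, ∀ f ∈ V, twistedTranslate k l f ∈ V

/-- `U : V → V` commutes with all twisted translations, for a twisted shift-invariant `V`. -/
def IsTwistedShiftPreserving {n : ℕ} (V : Submodule ℂ (L2Phase n)) (U : V →L[ℂ] V) : Prop :=
  ∀ k l : Fin n → ℤ, ∀ f g : V, (g : L2Phase n) = twistedTranslate k l (f : L2Phase n) →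
    (U g : L2Phase n) = twistedTranslate k l (U f : L2Phase n)

/-- `J` is the range function of `V`: for almost every `p`, `J p` is the closed linear span of the
vectors `𝒥 f p`, `f ∈ V`. As each `𝒥 f` is only defined almost everywhere, the span has to be taken
over a countable set of `f`s; here it is the range of a dense sequence in `V`. Any two dense sequences
give the same `J p` for almost every `p`. -/
def IsRangeFunction {n : ℕ} (V : Submodule ℂ (L2Phase n))
    (J : Torus n × Torus n → Submodule ℂ (L2Fiber n)) : Prop :=
  ∃ f : ℕ → V, DenseRange f ∧ ∀ᵐ p ∂(torusMeasure₂ n),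
    J p = (Submodule.span ℂ (Set.range fun i => fiberMap (f i : L2Phase n) p)).topologicalClosure

/-- `R` is a measurable range operator on `J` that corresponds to `U`: each `R p` is a bounded
operator from `J p` to `L²(ℝⁿ)`, the functions `p ↦ ⟨R p (P p a), b⟩` are (Lebesgue) measurable, where
`P p` is the orthogonal projection onto `J p`, and `𝒥 (U f) p = R p (𝒥 f p)` for almost every `p`,
for every `f ∈ V`. -/
structure IsRangeOperator {n : ℕ} (V : Submodule ℂ (L2Phase n))
    (J : Torus n × Torus n → Submodule ℂ (L2Fiber n)) [∀ p, CompleteSpace (J p)]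
    (U : V →L[ℂ] V) (R : ∀ p, J p →L[ℂ] L2Fiber n) : Prop where
  aemeasurable : ∀ a b : L2Fiber n,
    AEMeasurable (fun p => inner ℂ b (R p ((J p).orthogonalProjectionOnto a))) (torusMeasure₂ n)
  apply_eq : ∀ f : V, ∀ᵐ p ∂(torusMeasure₂ n), ∃ h : fiberMap (f : L2Phase n) p ∈ J p,
    fiberMap (U f : L2Phase n) p = R p ⟨fiberMap (f : L2Phase n) p, h⟩

open Classical in
/-- An operator `T` on a subspace `S` of `H` that takes its values in `S`, regarded as an operator
`S → S`. (If `T` does not map `S` into `S`, the value is `0`.) -/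
noncomputable def asEndomorphism {H : Type*} [NormedAddCommGroup H] [InnerProductSpace ℂ H]
    (S : Submodule ℂ H) (T : S →L[ℂ] H) : S →L[ℂ] S :=
  if h : ∀ a, T a ∈ S then T.codRestrict S h else 0

/-! Shift preserving operators are decomposable because `fiberMap` diagonalises the twisted
translations. The twisted translation by `(k, l)` acts on Weyl kernels as `K ↦ exp(πi k·l) exp(2πi
k·ξ) K(ξ + l, η)`, and summing over the lattice turns this into multiplication by `shiftPhase k l`,
a unimodular constant times a character of `𝕋ⁿ × 𝕋ⁿ` (`weylZak_twistedTranslate`). Every character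
occurs, and the transform is isometric: terms with different `m` are orthogonal in `ξ'`, and the
unit cubes tile `ℝⁿ`.

Hence if two fibrewise inner products have equal integrals after every translation of one argument,
they have the same Fourier coefficients and agree almost everywhere. This yields two facts. Elements
of `V` may be cut off fibrewise by measurable sets (`exists_fiberMap_eq_indicator`), and if `U` acts
through the field `Q`, then its adjoint acts through the adjoint field (`Implements.adjoint`).

The relation `Implements` respects sums, scalar multiples, products and adjoints, and determines the
field up to null sets. So an equation between operators on `V` holds exactly when it holds in almost
every fibre; unitarity is a pair of such equations. Positivity also passes both ways, by integration
in one direction and by cutting off in the other. Part (ii) then becomes the two inequalities `A ≤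
U` and `U ≤ B`. Throughout, statements valid for each vector almost everywhere are made uniform by a
countable family whose fibres are dense in almost every `J p`. -/

/-! ### Uniqueness of Fourier coefficients on the torus -/

theorem integral_fourier_unitAddCircle {k : ℤ} (hk : k ≠ 0) :
    ∫ x : UnitAddCircle, fourier k x ∂AddCircle.haarAddCircle = 0 :=
  integral_eq_zero_of_add_right_eq_neg (μ := AddCircle.haarAddCircle)
    (fourier_add_half_inv_index hk one_pos)

theorem integral_mFourier_torusMeasure {n : ℕ} {k : Fin n → ℤ} (hk : k ≠ 0) :
    ∫ x, UnitAddTorus.mFourier k x ∂torusMeasure n = 0 := by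
  obtain ⟨i, hi⟩ := Function.ne_iff.1 hk
  have h : ∫ x, UnitAddTorus.mFourier k x ∂torusMeasure n
      = ∏ i, ∫ t : UnitAddCircle, fourier (k i) t ∂AddCircle.haarAddCircle :=
    integral_fintype_prod_eq_prod (𝕜 := ℂ) (fun i (t : UnitAddCircle) => fourier (k i) t)
  rw [h]
  exact Finset.prod_eq_zero (Finset.mem_univ i) (integral_fourier_unitAddCircle hi)

theorem norm_mFourier_apply {n : ℕ} (k : Fin n → ℤ) (x : Torus n) :
    ‖UnitAddTorus.mFourier k x‖ = 1 := by
  simp [UnitAddTorus.mFourier, norm_prod, Circle.norm_coe]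

/-- An integrable function whose integrals against all continuous functions vanish is zero. -/
theorem ae_eq_zero_of_integral_continuous_mul {X : Type*} [PseudoMetricSpace X] [MeasurableSpace X]
    [BorelSpace X] [CompactSpace X] {μ : Measure X} [IsFiniteMeasure μ] {h : X → ℂ}
    (hh : Integrable h μ) (H : ∀ φ : C(X, ℂ), ∫ x, φ x * h x ∂μ = 0) : h =ᵐ[μ] 0 := by
  refine ae_eq_zero_of_forall_setIntegral_isClosed_eq_zero hh fun s hs => ?_
  obtain ⟨δ, -, hδ, hδ0⟩ := exists_seq_strictAnti_tendsto (0 : ℝ)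
  -- The indicator of a closed set is the pointwise limit of continuous thickened indicators bounded
  -- by one, so dominated convergence applies.
  have key : Filter.Tendsto (fun j => ∫ x, ((thickenedIndicator (hδ j) s x : ℝ) : ℂ) * h x ∂μ)
      Filter.atTop (nhds (∫ x, s.indicator h x ∂μ)) := by
    refine tendsto_integral_of_dominated_convergence (fun x => ‖h x‖) (fun j => ?_) hh.norm
      (fun j => .of_forall fun x => ?_) (.of_forall fun x => ?_)
    · refine AEStronglyMeasurable.mul (Continuous.aestronglyMeasurable ?_) hh.1
      exact Complex.continuous_ofReal.comp
        (NNReal.continuous_coe.comp (thickenedIndicator (hδ j) s).continuous)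
    · rw [norm_mul, Complex.norm_real, NNReal.norm_eq]
      exact mul_le_of_le_one_left (norm_nonneg _) (thickenedIndicator_le_one _ s x)
    · have h1 := (tendsto_pi_nhds.1 (thickenedIndicator_tendsto_indicator_closure hδ hδ0 s)) x
      rw [hs.closure_eq] at h1
      have h2 : s.indicator h x
          = (Complex.ofReal ∘ NNReal.toReal) (s.indicator (fun _ => (1 : NNReal)) x) * h x := by
        by_cases hx : x ∈ s <;> simp [hx]
      rw [h2]
      exact ((Complex.continuous_ofReal.comp NNReal.continuous_coe).continuousAt.tendsto.comp
        h1).mul_const (h x)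
  rw [← integral_indicator hs.measurableSet]
  refine tendsto_nhds_unique key (tendsto_const_nhds.congr fun j => ?_)
  exact (H ⟨fun x => ((thickenedIndicator (hδ j) s x : ℝ) : ℂ), Complex.continuous_ofReal.comp
        (NNReal.continuous_coe.comp (thickenedIndicator (hδ j) s).continuous)⟩).symm

/-- Integration against `h` is a bounded functional on the continuous functions. It kills the
characters, whose span is dense, so it vanishes. -/
theorem torus_ae_eq_zero {n : ℕ} {h : Torus n → ℂ} (hh : Integrable h (torusMeasure n))
    (H : ∀ k, ∫ x, UnitAddTorus.mFourier k x * h x ∂torusMeasure n = 0) :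
    h =ᵐ[torusMeasure n] 0 := by
  refine ae_eq_zero_of_integral_continuous_mul hh fun φ => ?_
  have hint : ∀ φ : C(Torus n, ℂ), Integrable (fun x => φ x * h x) (torusMeasure n) := fun φ =>
    hh.bdd_mul φ.continuous.aestronglyMeasurable (.of_forall φ.norm_coe_le_norm)
  let T : C(Torus n, ℂ) →L[ℂ] ℂ := LinearMap.mkContinuous
    { toFun := fun φ => ∫ x, φ x * h x ∂torusMeasure n
      map_add' := fun φ ψ => by
        simp only [ContinuousMap.add_apply, add_mul]
        exact integral_add (hint φ) (hint ψ)
      map_smul' := fun c φ => by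
        simp only [ContinuousMap.smul_apply, smul_eq_mul, mul_assoc, RingHom.id_apply]
        exact integral_const_mul _ _ } (∫ x, ‖h x‖ ∂torusMeasure n) fun φ => by
      refine (norm_integral_le_integral_norm _).trans ?_
      rw [mul_comm, ← integral_const_mul]
      refine integral_mono (hint φ).norm (hh.norm.const_mul _) fun x => ?_
      simp only [norm_mul]
      gcongr
      exact φ.norm_coe_le_norm x
  have hspan : Submodule.span ℂ (Set.range (UnitAddTorus.mFourier (d := Fin n)))
      ≤ LinearMap.ker T.toLinearMap := by
    rw [Submodule.span_le]
    rintro _ ⟨k, rfl⟩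
    exact H k
  have hcl := Submodule.topologicalClosure_minimal _ hspan T.isClosed_ker
  rw [UnitAddTorus.span_mFourier_closure_eq_top] at hcl
  exact hcl (Submodule.mem_top (x := φ))

/-- Uniqueness of Fourier coefficients in `L¹(𝕋ⁿ × 𝕋ⁿ)`. -/
theorem torus₂_ae_eq_zero {n : ℕ} {h : Torus n × Torus n → ℂ}
    (hh : Integrable h (torusMeasure₂ n))
    (H : ∀ k l, ∫ p, UnitAddTorus.mFourier k p.1 * UnitAddTorus.mFourier l p.2 * h p
      ∂torusMeasure₂ n = 0) :
    h =ᵐ[torusMeasure₂ n] 0 := by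
  have h1 : ∀ l : Fin n → ℤ, ∀ᵐ x ∂torusMeasure n,
      ∫ y, UnitAddTorus.mFourier l y * h (x, y) ∂torusMeasure n = 0 := by
    intro l
    have hi : Integrable (fun p : Torus n × Torus n => UnitAddTorus.mFourier l p.2 * h p)
        (torusMeasure₂ n) :=
      hh.bdd_mul (c := 1) (Continuous.aestronglyMeasurable (by fun_prop))
        (.of_forall fun p => (norm_mFourier_apply l p.2).le)
    refine torus_ae_eq_zero hi.integral_prod_left fun k => ?_
    rw [← H k l]
    have hi2 : Integrable (fun p : Torus n × Torus n =>
        UnitAddTorus.mFourier k p.1 * UnitAddTorus.mFourier l p.2 * h p) (torusMeasure₂ n) := by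
      simp only [mul_assoc]
      exact hi.bdd_mul (c := 1) (Continuous.aestronglyMeasurable (by fun_prop))
        (.of_forall fun p => (norm_mFourier_apply k p.1).le)
    rw [integral_prod _ hi2]
    simp only [mul_assoc, integral_const_mul]
  -- There are only countably many `l`, so one null set of `x` serves them all, and uniqueness in
  -- the second variable applies.
  have h2 : ∀ᵐ x ∂torusMeasure n, ∀ᵐ y ∂torusMeasure n, h (x, y) = 0 := by
    filter_upwards [ae_all_iff.2 h1, hh.prod_right_ae] with x hx hx2
    exact torus_ae_eq_zero hx2 hx
  -- Tonelli for `‖h‖` turns iterated vanishing into vanishing almost everywhere for the product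
  -- measure.
  have h3 : ∫⁻ p, ‖h p‖ₑ ∂torusMeasure₂ n = 0 := by
    rw [lintegral_prod _ hh.1.enorm]
    refine (lintegral_congr_ae ?_).trans lintegral_zero
    filter_upwards [h2] with x hx
    refine (lintegral_congr_ae ?_).trans lintegral_zero
    filter_upwards [hx] with y hy
    simp [hy]
  filter_upwards [(lintegral_eq_zero_iff' hh.1.enorm).1 h3] with p hp
  simpa using hp

/-! ### Tiling of `ℝⁿ` by lattice cubes -/

/-- The half-open unit cube of `ℝⁿ` with lower corner `k`. -/
def latticeCube {n : ℕ} (k : Fin n → ℤ) : Set (EucSp n) :=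
  {x | ∀ i, x i ∈ Set.Ioc (k i : ℝ) (k i + 1)}

theorem measurableSet_latticeCube {n : ℕ} (k : Fin n → ℤ) : MeasurableSet (latticeCube k) := by
  have : latticeCube k = ⋂ i, (fun x : EucSp n => x i) ⁻¹' Set.Ioc (k i : ℝ) (k i + 1) := by
    ext x; simp [latticeCube]
  rw [this]
  exact MeasurableSet.iInter fun i => measurableSet_Ioc.preimage (by fun_prop)

theorem pairwise_disjoint_latticeCube {n : ℕ} :
    Pairwise (Function.onFun Disjoint (latticeCube (n := n))) := by
  intro k l hkl
  refine Set.disjoint_left.2 fun x hk hl => hkl (funext fun i => ?_)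
  have h1 := hk i
  have h2 := hl i
  have a : (k i : ℝ) < l i + 1 := h1.1.trans_le h2.2
  have b : (l i : ℝ) < k i + 1 := h2.1.trans_le h1.2
  norm_cast at a b
  omega

theorem iUnion_latticeCube {n : ℕ} : ⋃ k, latticeCube (n := n) k = Set.univ := by
  refine Set.eq_univ_of_forall fun x => Set.mem_iUnion.2 ⟨fun i => ⌈x i⌉ - 1, fun i => ?_⟩
  have h1 := Int.ceil_lt_add_one (x i)
  have h2 := Int.le_ceil (x i)
  push_cast
  exact ⟨by linarith, by linarith⟩

/-- The exact push-forward, not merely a bound by Lebesgue measure, is what makes the Zak series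
norm preserving. -/
theorem map_torusRep_add_latticeVec {n : ℕ} (k : Fin n → ℤ) :
    (torusMeasure n).map (fun ξ : Torus n => torusRep ξ + latticeVec k)
      = volume.restrict (latticeCube k) := by
  have hS : MeasurableSet {x : Fin n → ℝ | ∀ i, x i ∈ Set.Ioc ((0 : Fin n → ℝ) i)
      ((0 : Fin n → ℝ) i + 1)} :=
    MeasurableSet.univ_pi' fun i => measurableSet_Ioc
  have h1 := UnitAddTorus.measurePreserving_equivPiIoc (0 : Fin n → ℝ)
  have h2 : MeasurePreserving (fun x : Fin n → ℝ => WithLp.toLp 2 x + latticeVec k)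
      volume volume :=
    (measurePreserving_add_right volume (latticeVec k)).comp (PiLp.volume_preserving_toLp (Fin n))
  have hm : Measurable (fun ξ : Torus n =>
      ((UnitAddTorus.measurableEquivPiIoc (0 : Fin n → ℝ) ξ) : Fin n → ℝ)) :=
    measurable_subtype_coe.comp (MeasurableEquiv.measurable _)
  have heq : (fun ξ : Torus n => torusRep ξ + latticeVec k)
      = (fun x : Fin n → ℝ => WithLp.toLp 2 x + latticeVec k) ∘
        fun ξ : Torus n => ((UnitAddTorus.measurableEquivPiIoc (0 : Fin n → ℝ) ξ) : Fin n → ℝ) :=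
    rfl
  rw [heq, ← Measure.map_map h2.measurable hm]
  have h3 : (torusMeasure n).map (UnitAddTorus.measurableEquivPiIoc (0 : Fin n → ℝ))
      = Measure.comap Subtype.val volume := h1.map_eq
  have h4 := Measure.map_map (μ := torusMeasure n) measurable_subtype_coe
    (UnitAddTorus.measurableEquivPiIoc (0 : Fin n → ℝ)).measurable
  rw [h3] at h4
  replace h4 := (map_comap_subtype_coe hS volume).symm.trans h4
  have h5 : (torusMeasure n).map (fun ξ : Torus n =>
      ((UnitAddTorus.measurableEquivPiIoc (0 : Fin n → ℝ) ξ) : Fin n → ℝ))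
      = volume.restrict {x : Fin n → ℝ | ∀ i, x i ∈ Set.Ioc ((0 : Fin n → ℝ) i)
        ((0 : Fin n → ℝ) i + 1)} := h4.symm
  rw [h5, ← (h2.restrict_preimage (measurableSet_latticeCube k)).map_eq]
  congr 2
  ext x
  refine forall_congr' fun i => ?_
  simp only [latticeVec, Pi.zero_apply, Set.mem_Ioc, PiLp.add_apply]
  constructor <;> rintro ⟨h, h'⟩ <;> constructor <;> linarith

/-! ### Weighted composition operators on `L²` -/

section WeightedComp

variable {α β : Type*} [MeasurableSpace α] [MeasurableSpace β] {μ : Measure α} {ν : Measure β}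

theorem eLpNorm_mul_comp {φ : α → β} {u : α → ℂ} {f : β → ℂ} (hφ : Measurable φ)
    (hu1 : ∀ x, ‖u x‖ = 1) (hf : AEStronglyMeasurable f (μ.map φ)) :
    eLpNorm (fun x => u x * f (φ x)) 2 μ = eLpNorm f 2 (μ.map φ) := by
  rw [eLpNorm_map_measure hf hφ.aemeasurable]
  exact eLpNorm_congr_norm_ae (.of_forall fun x => by simp [hu1])

/-- Domination of the push-forward is assumed instead of equality, since a single Zak term sees only
one cube. -/
theorem memLp_mul_comp {φ : α → β} {u : α → ℂ} {f : β → ℂ} (hφ : Measurable φ)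
    (hle : μ.map φ ≤ ν) (hu : Measurable u) (hu1 : ∀ x, ‖u x‖ = 1) (hf : MemLp f 2 ν) :
    MemLp (fun x => u x * f (φ x)) 2 μ := by
  have h := hf.mono_measure hle
  refine ⟨hu.aestronglyMeasurable.mul (h.1.comp_measurable hφ), ?_⟩
  rw [eLpNorm_mul_comp hφ hu1 h.1]
  exact h.2

/-- The operator `f ↦ u · (f ∘ φ)` on `L²`, for a unimodular weight `u`. -/
noncomputable def weightedComp (φ : α → β) (u : α → ℂ) (hφ : Measurable φ)
    (hle : μ.map φ ≤ ν) (hu : Measurable u) (hu1 : ∀ x, ‖u x‖ = 1) :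
    Lp ℂ 2 ν →L[ℂ] Lp ℂ 2 μ :=
  LinearMap.mkContinuous
    { toFun := fun f => (memLp_mul_comp hφ hle hu hu1 (Lp.memLp f)).toLp _
      map_add' := fun f g => by
        rw [← MemLp.toLp_add]
        refine MemLp.toLp_congr _ _ ?_
        have hq : Measure.QuasiMeasurePreserving φ μ ν := ⟨hφ, hle.absolutelyContinuous⟩
        filter_upwards [hq.ae (Lp.coeFn_add f g)] with x hx
        rw [hx, Pi.add_apply, mul_add]
        rfl
      map_smul' := fun c f => by
        rw [RingHom.id_apply, ← MemLp.toLp_const_smul]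
        refine MemLp.toLp_congr _ _ ?_
        have hq : Measure.QuasiMeasurePreserving φ μ ν := ⟨hφ, hle.absolutelyContinuous⟩
        filter_upwards [hq.ae (Lp.coeFn_smul c f)] with x hx
        simp only [hx, Pi.smul_apply, smul_eq_mul]
        ring } 1 fun f => by
    rw [one_mul]
    change ‖(memLp_mul_comp hφ hle hu hu1 (Lp.memLp f)).toLp _‖ ≤ _
    rw [Lp.norm_toLp, Lp.norm_def, eLpNorm_mul_comp hφ hu1 ((Lp.memLp f).mono_measure hle).1]
    exact ENNReal.toReal_mono (Lp.eLpNorm_ne_top f) (eLpNorm_mono_measure _ hle)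

theorem coeFn_weightedComp {φ : α → β} {u : α → ℂ} (hφ : Measurable φ)
    (hle : μ.map φ ≤ ν) (hu : Measurable u) (hu1 : ∀ x, ‖u x‖ = 1) (f : Lp ℂ 2 ν) :
    weightedComp φ u hφ hle hu hu1 f =ᵐ[μ] fun x => u x * f (φ x) :=
  MemLp.coeFn_toLp (memLp_mul_comp hφ hle hu hu1 (Lp.memLp f))

end WeightedComp

/-! ### Twisted translations on Weyl kernels -/

theorem Complex.norm_exp_pi_I_mul (t : ℝ) : ‖Complex.exp (Real.pi * Complex.I * t)‖ = 1 := by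
  rw [show (Real.pi * Complex.I * t : ℂ) = ((Real.pi * t : ℝ) : ℂ) * Complex.I by push_cast; ring,
    Complex.norm_exp_ofReal_mul_I]

/-- The twisted translation as a bounded operator. -/
noncomputable def twistedTranslateL {n : ℕ} (k l : Fin n → ℤ) : L2Phase n →L[ℂ] L2Phase n :=
  weightedComp (fun z : EucSp n × EucSp n => (z.1 - latticeVec k, z.2 - latticeVec l))
    (fun z => Complex.exp (Real.pi * Complex.I *
      (inner ℝ z.1 (latticeVec l) - inner ℝ z.2 (latticeVec k) : ℝ)))
    (by fun_prop) (measurePreserving_shift (latticeVec k, latticeVec l)).map_eq.le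
    (Continuous.measurable (by fun_prop)) fun z => Complex.norm_exp_pi_I_mul _

theorem twistedTranslateL_apply {n : ℕ} (k l : Fin n → ℤ) (f : L2Phase n) :
    twistedTranslateL k l f = twistedTranslate k l f := rfl

/-- The action of a twisted translation on kernels:
`K ↦ exp(π i k·l) exp(2π i k·ξ) K(ξ + l, η)`. -/
noncomputable def kernelTranslate {n : ℕ} (k l : Fin n → ℤ) : L2Phase n →L[ℂ] L2Phase n :=
  weightedComp (fun z : EucSp n × EucSp n => (z.1 + latticeVec l, z.2))
    (fun z => Complex.exp (Real.pi * Complex.I * (inner ℝ (latticeVec k) (latticeVec l)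
      + 2 * inner ℝ (latticeVec k) z.1 : ℝ)))
    (by fun_prop)
    ((measurePreserving_add_right volume (latticeVec l)).prod
      (MeasurePreserving.id volume)).map_eq.le
    (Continuous.measurable (by fun_prop)) fun z => Complex.norm_exp_pi_I_mul _

/-- Substitute `x + k` for `x`. The contributions `k·η` of the twist and of the Weyl exponential
cancel, while those of `k·ξ` add up to `2 k·ξ`; the remaining `x·l` is absorbed in replacing `ξ` by
`ξ + l`. -/
theorem weylKernelIntegral_twistedTranslateFun {n : ℕ} (k l : Fin n → ℤ)
    (f : EucSp n × EucSp n → ℂ) (z : EucSp n × EucSp n) :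
    weylKernelIntegral n (twistedTranslateFun k l f) z =
      Complex.exp (Real.pi * Complex.I * (inner ℝ (latticeVec k) (latticeVec l)
        + 2 * inner ℝ (latticeVec k) z.1 : ℝ)) *
        weylKernelIntegral n f (z.1 + latticeVec l, z.2) := by
  rw [weylKernelIntegral, weylKernelIntegral, ← integral_const_mul,
    ← integral_add_right_eq_self _ (latticeVec k)]
  congr 1
  ext x
  simp only [twistedTranslateFun, add_sub_cancel_right, sub_sub]
  rw [add_comm z.1 (latticeVec l), mul_right_comm, ← Complex.exp_add, mul_left_comm,
    ← Complex.exp_add, mul_comm]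
  congr 2
  simp only [inner_add_left, inner_add_right, inner_sub_right, real_inner_comm (latticeVec k)]
  push_cast
  ring

theorem weylKernel_twistedTranslate {n : ℕ} (k l : Fin n → ℤ) (f : L2Phase n) :
    weylKernel n (twistedTranslate k l f) = kernelTranslate k l (weylKernel n f) := by
  refine (dense_l1l2 n).induction_on (p := fun f => weylKernel n (twistedTranslateL k l f)
    = kernelTranslate k l (weylKernel n f)) f (isClosed_eq (by fun_prop) (by fun_prop)) fun g => ?_
  have hae : twistedTranslateL k l (g : L2Phase n)
      =ᵐ[volume] twistedTranslateFun k l (g : L2Phase n) :=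
    MemLp.coeFn_toLp (memLp_twistedTranslateFun k l (Lp.memLp (g : L2Phase n)))
  have hg : Integrable (g : L2Phase n) := g.2
  have hint : Integrable (twistedTranslateFun k l (g : L2Phase n)) :=
    ((measurePreserving_shift (latticeVec k, latticeVec l)).integrable_comp_of_integrable
      hg).bdd_mul (c := 1) (Continuous.aestronglyMeasurable (by fun_prop))
        (.of_forall fun z => (Complex.norm_exp_pi_I_mul _).le)
  let g' : l1l2 n := ⟨twistedTranslateL k l (g : L2Phase n), hint.congr hae.symm⟩
  have e1 : weylKernel n (twistedTranslateL k l (g : L2Phase n)) = _ := weylKernel_eq g'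
  have e2 := weylKernel_eq g
  change weylKernel n (twistedTranslateL k l (g : L2Phase n))
    = kernelTranslate k l (weylKernel n (g : L2Phase n))
  rw [e1, e2]
  refine Lp.ext ((MemLp.coeFn_toLp _).trans ?_)
  have hq : MeasurePreserving (fun z : EucSp n × EucSp n => (z.1 + latticeVec l, z.2)) :=
    (measurePreserving_add_right volume (latticeVec l)).prod (MeasurePreserving.id volume)
  refine (weylKernelIntegral_congr hae).trans ?_
  refine .trans ?_ (coeFn_weightedComp _ _ _ _ _).symm
  filter_upwards [hq.quasiMeasurePreserving.ae (memLp_weylKernelIntegral g).coeFn_toLp] with z hz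
  rw [hz, weylKernelIntegral_twistedTranslateFun]

/-! ### The Weyl–Zak transform is isometric -/

theorem summable_of_pairwise_orthogonal {ι E : Type*} [NormedAddCommGroup E]
    [InnerProductSpace ℂ E] [CompleteSpace E] {x : ι → E}
    (ho : ∀ i j, i ≠ j → inner ℂ (x i) (x j) = 0) (hs : Summable fun i => ‖x i‖ ^ 2) :
    Summable x := by
  have hof := OrthogonalFamily.of_pairwise (𝕜 := ℂ) (V := fun i => ℂ ∙ x i) fun i j hij => by
    change (ℂ ∙ x i) ⟂ (ℂ ∙ x j)
    rw [Submodule.isOrtho_span]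
    rintro u rfl v rfl
    exact ho i j hij
  exact (hof.summable_iff_norm_sq_summable
    fun i => (⟨x i, Submodule.mem_span_singleton_self _⟩ : (ℂ ∙ x i : Submodule ℂ E))).2 hs

theorem inner_tsum_self_of_pairwise_orthogonal {ι E : Type*} [NormedAddCommGroup E]
    [InnerProductSpace ℂ E] {x : ι → E}
    (ho : ∀ i j, i ≠ j → inner ℂ (x i) (x j) = 0) (hs : Summable x) :
    inner ℂ (∑' i, x i) (∑' i, x i) = ∑' i, inner ℂ (x i) (x i) := by
  have h1 : ∀ i, inner ℂ (x i) (∑' j, x j) = inner ℂ (x i) (x i) := fun i => by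
    have h : HasSum (fun j => inner ℂ (x i) (x j)) (inner ℂ (x i) (∑' j, x j)) :=
      hs.hasSum.mapL (innerSL ℂ (x i))
    exact h.unique (hasSum_single i fun j hj => ho i j hj.symm)
  have h2 : HasSum (fun i => inner ℂ (∑' j, x j) (x i)) (inner ℂ (∑' j, x j) (∑' j, x j)) :=
    hs.hasSum.mapL (innerSL ℂ (∑' j, x j))
  rw [← h2.tsum_eq]
  refine tsum_congr fun i => ?_
  rw [← inner_conj_symm, h1, inner_conj_symm]

/-- The measure on `𝕋ⁿ × 𝕋ⁿ × ℝⁿ`. -/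
noncomputable abbrev zakMeasure (n : ℕ) : Measure ((Torus n × Torus n) × EucSp n) :=
  (torusMeasure₂ n).prod volume

theorem measurable_zakShift {n : ℕ} (m : Fin n → ℤ) :
    Measurable fun w : (Torus n × Torus n) × EucSp n => (latticeVec m + torusRep w.1.1, w.2) := by
  have h := (map_torusRep_le n (latticeVec m)).1
  simp only [add_comm _ (latticeVec m)] at h
  exact (h.comp (measurable_fst.comp measurable_fst)).prodMk measurable_snd

theorem map_zakShift {n : ℕ} (m : Fin n → ℤ) :
    (zakMeasure n).map (fun w => (latticeVec m + torusRep w.1.1, w.2))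
      = volume.restrict (latticeCube m ×ˢ (Set.univ : Set (EucSp n))) := by
  have hm := (map_torusRep_le n (latticeVec m)).1
  have hfst : MeasurePreserving (Prod.fst : Torus n × Torus n → Torus n) (torusMeasure₂ n)
      (torusMeasure n) := measurePreserving_fst
  have h := ((hm.measurePreserving (torusMeasure n)).comp hfst).prod
    (MeasurePreserving.id (volume : Measure (EucSp n)))
  rw [map_torusRep_add_latticeVec] at h
  rw [Measure.volume_eq_prod, ← Measure.prod_restrict, Measure.restrict_univ, ← h.map_eq]
  congr 1
  ext1 w
  exact Prod.ext (add_comm _ _) rfl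

/-- One term of the Zak series, as an operator on kernels. -/
noncomputable def zakTerm {n : ℕ} (m : Fin n → ℤ) : L2Phase n →L[ℂ] Lp ℂ 2 (zakMeasure n) :=
  weightedComp (fun w => (latticeVec m + torusRep w.1.1, w.2))
    (fun w => UnitAddTorus.mFourier (-m) w.1.2) (measurable_zakShift m)
    ((map_zakShift m).le.trans Measure.restrict_le_self)
    (Continuous.measurable (by fun_prop)) fun w => norm_mFourier_apply _ _

theorem coeFn_zakTerm {n : ℕ} (m : Fin n → ℤ) (K : L2Phase n) :
    zakTerm m K =ᵐ[zakMeasure n] zakSummand K m :=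
  (coeFn_weightedComp _ _ _ _ _).trans (.of_forall fun _ => mul_comm _ _)

theorem weylZak_eq_tsum {n : ℕ} (f : L2Phase n) : weylZak f = ∑' m, zakTerm m (weylKernel n f) :=
  tsum_congr fun m => Lp.ext ((MemLp.coeFn_toLp _).trans (coeFn_zakTerm m _).symm)

/-- The integrand depends on `ξ'` only through the nontrivial character of index `m - m'`, whose
integral is zero. -/
theorem inner_zakTerm_of_ne {n : ℕ} {m m' : Fin n → ℤ} (h : m ≠ m') (K K' : L2Phase n) :
    inner ℂ (zakTerm m K) (zakTerm m' K') = 0 := by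
  have hint := L2.integrable_inner (𝕜 := ℂ) (zakTerm m K) (zakTerm m' K')
  have hae : (fun w => inner ℂ (zakTerm m K w) (zakTerm m' K' w)) =ᵐ[zakMeasure n] fun w =>
      UnitAddTorus.mFourier (m - m') w.1.2 *
        inner ℂ (K (latticeVec m + torusRep w.1.1, w.2))
          (K' (latticeVec m' + torusRep w.1.1, w.2)) := by
    filter_upwards [coeFn_zakTerm m K, coeFn_zakTerm m' K'] with w h1 h2
    rw [h1, h2, zakSummand, zakSummand, sub_eq_add_neg, UnitAddTorus.mFourier_add,
      UnitAddTorus.mFourier_neg (n := m)]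
    simp only [RCLike.inner_apply, map_mul, Complex.conj_conj]
    ring
  rw [L2.inner_def, integral_congr_ae hae, integral_prod _ (hint.congr hae)]
  simp only [integral_const_mul]
  have := integral_prod_mul (μ := torusMeasure n) (ν := torusMeasure n)
    (fun ξ : Torus n => ∫ η : EucSp n, inner ℂ (K (latticeVec m + torusRep ξ, η))
          (K' (latticeVec m' + torusRep ξ, η)))
    (fun ξ' : Torus n => UnitAddTorus.mFourier (m - m') ξ')
  rw [integral_mFourier_torusMeasure (sub_ne_zero.2 h), mul_zero] at this
  rw [← this]
  simp only [mul_comm]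

theorem inner_zakTerm_self {n : ℕ} (m : Fin n → ℤ) (K : L2Phase n) :
    inner ℂ (zakTerm m K) (zakTerm m K)
      = ∫ z in latticeCube m ×ˢ (Set.univ : Set (EucSp n)), inner ℂ (K z) (K z) := by
  have hint := L2.integrable_inner (𝕜 := ℂ) K K
  rw [← map_zakShift, integral_map (measurable_zakShift m).aemeasurable, L2.inner_def]
  · refine integral_congr_ae ?_
    filter_upwards [coeFn_zakTerm m K] with w h1
    rw [h1, zakSummand]
    simp only [inner_self_eq_norm_sq_to_K, norm_mul, norm_mFourier_apply, mul_one]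
  · rw [map_zakShift]
    exact hint.1.restrict

/-- The term of index `m` carries exactly the mass of `K` over the cube at `m`, and the cubes
partition the space. -/
theorem hasSum_inner_zakTerm_self {n : ℕ} (K : L2Phase n) :
    HasSum (fun m => inner ℂ (zakTerm m K) (zakTerm m K)) (inner ℂ K K) := by
  have hU : ⋃ m : Fin n → ℤ, latticeCube m ×ˢ (Set.univ : Set (EucSp n)) = Set.univ := by
    rw [← Set.iUnion_prod_const, iUnion_latticeCube, Set.univ_prod_univ]
  have h := hasSum_integral_iUnion (μ := (volume : Measure (EucSp n × EucSp n)))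
    (s := fun m : Fin n → ℤ => latticeCube m ×ˢ (Set.univ : Set (EucSp n)))
    (f := fun z => inner ℂ (K z) (K z))
    (fun m => (measurableSet_latticeCube m).prod MeasurableSet.univ)
    (fun m m' hm => Set.Disjoint.set_prod_left (pairwise_disjoint_latticeCube hm) _ _)
    (L2.integrable_inner (𝕜 := ℂ) K K).integrableOn
  rw [hU, Measure.restrict_univ, ← L2.inner_def] at h
  simpa only [inner_zakTerm_self] using h

theorem summable_zakTerm {n : ℕ} (K : L2Phase n) : Summable fun m => zakTerm m K := by
  refine summable_of_pairwise_orthogonal (fun m m' h => inner_zakTerm_of_ne h K K) ?_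
  have h := (hasSum_inner_zakTerm_self K).mapL Complex.reCLM
  refine h.summable.congr fun m => ?_
  exact (norm_sq_eq_re_inner (𝕜 := ℂ) (zakTerm m K)).symm

theorem norm_tsum_zakTerm {n : ℕ} (K : L2Phase n) : ‖∑' m, zakTerm m K‖ = ‖K‖ := by
  have h := inner_tsum_self_of_pairwise_orthogonal
    (fun m m' h => inner_zakTerm_of_ne h K K) (summable_zakTerm K)
  rw [(hasSum_inner_zakTerm_self K).tsum_eq, inner_self_eq_norm_sq_to_K,
    inner_self_eq_norm_sq_to_K] at h
  norm_cast at h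
  exact (sq_eq_sq₀ (norm_nonneg _) (norm_nonneg _)).1 h

/-- The Weyl–Zak transform as a linear isometry. -/
noncomputable def weylZakIsometry (n : ℕ) : L2Phase n →ₗᵢ[ℂ] Lp ℂ 2 (zakMeasure n) where
  toFun f := weylZak f
  map_add' f g := by
    simp only [weylZak_eq_tsum, map_add]
    exact (summable_zakTerm _).tsum_add (summable_zakTerm _)
  map_smul' c f := by
    simp only [weylZak_eq_tsum, map_smul, RingHom.id_apply]
    exact (summable_zakTerm _).tsum_const_smul c
  norm_map' f := by
    change ‖weylZak f‖ = ‖f‖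
    rw [weylZak_eq_tsum, norm_tsum_zakTerm, norm_weylKernel]

theorem weylZakIsometry_apply {n : ℕ} (f : L2Phase n) : weylZakIsometry n f = weylZak f := rfl

/-! ### Twisted translations become multiplication by characters -/

/-- The multiplier on `𝕋ⁿ × 𝕋ⁿ` through which a twisted translation acts. -/
noncomputable def shiftPhase {n : ℕ} (k l : Fin n → ℤ) (p : Torus n × Torus n) : ℂ :=
  Complex.exp (Real.pi * Complex.I * (inner ℝ (latticeVec k) (latticeVec l) : ℝ)) *
    (UnitAddTorus.mFourier k p.1 * UnitAddTorus.mFourier l p.2)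

theorem norm_shiftPhase {n : ℕ} (k l : Fin n → ℤ) (p : Torus n × Torus n) :
    ‖shiftPhase k l p‖ = 1 := by
  rw [shiftPhase, norm_mul, norm_mul, norm_mFourier_apply, norm_mFourier_apply,
    Complex.norm_exp_pi_I_mul]
  norm_num

@[fun_prop]
theorem continuous_shiftPhase {n : ℕ} (k l : Fin n → ℤ) :
    Continuous (shiftPhase (n := n) k l) := by
  unfold shiftPhase
  fun_prop

/-- Multiplication by `shiftPhase`. -/
noncomputable def phaseMul {n : ℕ} (k l : Fin n → ℤ) :
    Lp ℂ 2 (zakMeasure n) →L[ℂ] Lp ℂ 2 (zakMeasure n) :=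
  weightedComp id (fun w => shiftPhase k l w.1) measurable_id Measure.map_id.le
    (Continuous.measurable (by fun_prop)) fun w => norm_shiftPhase k l w.1

theorem coe_torusRep {n : ℕ} (ξ : Torus n) (i : Fin n) :
    ((torusRep ξ i : ℝ) : UnitAddCircle) = ξ i :=
  (AddCircle.equivIoc 1 0).symm_apply_apply (ξ i)

theorem mFourier_eq_exp_inner {n : ℕ} (k : Fin n → ℤ) (ξ : Torus n) :
    UnitAddTorus.mFourier k ξ
      = Complex.exp (2 * Real.pi * Complex.I * (inner ℝ (latticeVec k) (torusRep ξ) : ℝ)) := by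
  have h : ∀ i, fourier (k i) (ξ i)
      = Complex.exp (2 * Real.pi * Complex.I * (k i * torusRep ξ i)) := fun i => by
    conv_lhs => rw [← coe_torusRep ξ i]
    rw [fourier_coe_apply]
    congr 1
    push_cast
    ring
  change ∏ i, fourier (k i) (ξ i) = _
  simp only [h]
  rw [← Complex.exp_sum, ← Finset.mul_sum]
  congr 2
  simp [PiLp.inner_apply, latticeVec, mul_comm]

theorem exp_pi_I_inner_latticeVec {n : ℕ} (k m : Fin n → ℤ) :
    Complex.exp (2 * Real.pi * Complex.I * (inner ℝ (latticeVec k) (latticeVec m) : ℝ)) = 1 := by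
  rw [Complex.exp_eq_one_iff]
  refine ⟨∑ i, k i * m i, ?_⟩
  simp only [PiLp.inner_apply, latticeVec, RCLike.inner_apply, conj_trivial]
  push_cast
  rw [mul_comm]
  simp only [mul_comm]

theorem latticeVec_add {n : ℕ} (k l : Fin n → ℤ) :
    latticeVec (k + l) = latticeVec k + latticeVec l := by
  ext i
  simp [latticeVec]

/-- Translation by `l` moves the sample point from cube `m` to cube `m + l`. The factor `exp(2πi
k·m)` is one by integrality, and changing the index of the character in `ξ'` from `-m` to `-(m + l)`
leaves the factor `mFourier l`. -/
theorem zakTerm_kernelTranslate {n : ℕ} (k l m : Fin n → ℤ) (K : L2Phase n) :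
    zakTerm m (kernelTranslate k l K) = phaseMul k l (zakTerm (m + l) K) := by
  have hq : Measure.QuasiMeasurePreserving
      (fun w : (Torus n × Torus n) × EucSp n => (latticeVec m + torusRep w.1.1, w.2))
      (zakMeasure n) volume :=
    ⟨measurable_zakShift m,
      ((map_zakShift m).le.trans Measure.restrict_le_self).absolutelyContinuous⟩
  refine Lp.ext ((coeFn_zakTerm _ _).trans (.trans ?_ (coeFn_weightedComp _ _ _ _ _).symm))
  filter_upwards [hq.ae (coeFn_weightedComp _ _ _ _ K), coeFn_zakTerm (m + l) K] with w h1 h2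
  simp only [id, h2, zakSummand]
  refine (congrArg (· * _) h1).trans ?_
  have e1 : latticeVec m + torusRep w.1.1 + latticeVec l
      = latticeVec (m + l) + torusRep w.1.1 := by
    rw [latticeVec_add]; abel
  have e2 : Complex.exp (Real.pi * Complex.I * (inner ℝ (latticeVec k) (latticeVec l)
        + 2 * inner ℝ (latticeVec k) (latticeVec m + torusRep w.1.1) : ℝ))
      = Complex.exp (Real.pi * Complex.I * (inner ℝ (latticeVec k) (latticeVec l) : ℝ)) *
        UnitAddTorus.mFourier k w.1.1 := by
    rw [mFourier_eq_exp_inner, ← Complex.exp_add,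
      ← mul_one (Complex.exp (_ + 2 * _ * _ * _)), ← exp_pi_I_inner_latticeVec k m,
      ← Complex.exp_add]
    congr 1
    simp only [inner_add_right]
    push_cast
    ring
  have e3 : UnitAddTorus.mFourier (-m) w.1.2
      = UnitAddTorus.mFourier l w.1.2 * UnitAddTorus.mFourier (-(m + l)) w.1.2 := by
    rw [← UnitAddTorus.mFourier_add]
    congr 2
    abel
  rw [e1, e2, e3, shiftPhase]
  ring

theorem weylZak_twistedTranslate {n : ℕ} (k l : Fin n → ℤ) (f : L2Phase n) :
    weylZak (twistedTranslate k l f) = phaseMul k l (weylZak f) := by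
  rw [weylZak_eq_tsum, weylZak_eq_tsum, weylKernel_twistedTranslate,
    ContinuousLinearMap.map_tsum _ (summable_zakTerm _)]
  simp only [zakTerm_kernelTranslate]
  exact (Equiv.addRight l).tsum_eq fun m => phaseMul k l (zakTerm m (weylKernel n f))

/-! ### Fibres of `L²` functions -/

open Classical in
/-- The slice `η ↦ F (p, η)` of an `L²` function, set to `0` where it is not square integrable. -/
noncomputable def slice {n : ℕ} (F : Lp ℂ 2 (zakMeasure n)) (p : Torus n × Torus n) : L2Fiber n :=
  if h : MemLp (fun η : EucSp n => F (p, η)) 2 then h.toLp _ else 0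

theorem fiberMap_eq_slice {n : ℕ} (f : L2Phase n) (p : Torus n × Torus n) :
    fiberMap f p = slice (weylZak f) p := rfl

/-- Fubini for `‖F‖²`: the default value of `slice` occurs only on a null set. -/
theorem ae_memLp_slice {n : ℕ} (F : Lp ℂ 2 (zakMeasure n)) :
    ∀ᵐ p ∂torusMeasure₂ n, MemLp (fun η : EucSp n => F (p, η)) 2 := by
  have h1 : ∀ᵐ p ∂torusMeasure₂ n, Integrable (fun η : EucSp n => ‖F (p, η)‖ ^ 2) :=
    ((memLp_two_iff_integrable_sq_norm (Lp.memLp F).1).1 (Lp.memLp F)).prod_right_ae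
  filter_upwards [h1, (Lp.memLp F).1.prodMk_left] with p hp hm
  exact (memLp_two_iff_integrable_sq_norm hm).2 hp

theorem coeFn_slice {n : ℕ} (F : Lp ℂ 2 (zakMeasure n)) :
    ∀ᵐ p ∂torusMeasure₂ n, slice F p =ᵐ[volume] fun η => F (p, η) := by
  filter_upwards [ae_memLp_slice F] with p hp
  rw [slice, dif_pos hp]
  exact hp.coeFn_toLp

theorem slice_ae_of_ae {n : ℕ} {F : Lp ℂ 2 (zakMeasure n)}
    {G : (Torus n × Torus n) × EucSp n → ℂ} (h : F =ᵐ[zakMeasure n] G) :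
    ∀ᵐ p ∂torusMeasure₂ n, slice F p =ᵐ[volume] fun η => G (p, η) := by
  filter_upwards [coeFn_slice F, Measure.ae_ae_of_ae_prod h] with p h1 h2
  exact h1.trans h2

theorem slice_add {n : ℕ} (F G : Lp ℂ 2 (zakMeasure n)) :
    ∀ᵐ p ∂torusMeasure₂ n, slice (F + G) p = slice F p + slice G p := by
  filter_upwards [slice_ae_of_ae (Lp.coeFn_add F G), coeFn_slice F, coeFn_slice G] with p h hF hG
  refine Lp.ext ?_
  filter_upwards [h, hF, hG, Lp.coeFn_add (slice F p) (slice G p)] with η e1 e2 e3 e4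
  rw [e1, e4, Pi.add_apply, Pi.add_apply, e2, e3]

theorem slice_mul {n : ℕ} {F G : Lp ℂ 2 (zakMeasure n)} (c : Torus n × Torus n → ℂ)
    (h : G =ᵐ[zakMeasure n] fun w => c w.1 * F w) :
    ∀ᵐ p ∂torusMeasure₂ n, slice G p = c p • slice F p := by
  filter_upwards [slice_ae_of_ae h, coeFn_slice F] with p h hF
  refine Lp.ext ?_
  filter_upwards [h, hF, Lp.coeFn_smul (c p) (slice F p)] with η e1 e2 e3
  rw [e1, e3, Pi.smul_apply, e2, smul_eq_mul]

theorem inner_slice {n : ℕ} (F G : Lp ℂ 2 (zakMeasure n)) :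
    ∀ᵐ p ∂torusMeasure₂ n, ∫ η, inner ℂ (F (p, η)) (G (p, η))
      = inner ℂ (slice F p) (slice G p) := by
  filter_upwards [coeFn_slice F, coeFn_slice G] with p hF hG
  rw [L2.inner_def]
  refine integral_congr_ae ?_
  filter_upwards [hF, hG] with η e1 e2
  rw [e1, e2]

theorem integrable_inner_slice {n : ℕ} (F G : Lp ℂ 2 (zakMeasure n)) :
    Integrable (fun p => inner ℂ (slice F p) (slice G p)) (torusMeasure₂ n) :=
  (L2.integrable_inner (𝕜 := ℂ) F G).integral_prod_left.congr (inner_slice F G)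

theorem integral_inner_slice {n : ℕ} (F G : Lp ℂ 2 (zakMeasure n)) :
    ∫ p, inner ℂ (slice F p) (slice G p) ∂torusMeasure₂ n = inner ℂ F G := by
  rw [L2.inner_def, integral_prod _ (L2.integrable_inner (𝕜 := ℂ) F G)]
  exact (integral_congr_ae (inner_slice F G)).symm

/-- The twist `exp(πi k·l)` is a nonzero constant in `p`, so these integrals are the Fourier
coefficients up to nonzero factors. -/
theorem ae_eq_zero_of_integral_shiftPhase_mul {n : ℕ} {h : Torus n × Torus n → ℂ}
    (hh : Integrable h (torusMeasure₂ n))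
    (H : ∀ k l, ∫ p, shiftPhase k l p * h p ∂torusMeasure₂ n = 0) :
    h =ᵐ[torusMeasure₂ n] 0 := by
  refine torus₂_ae_eq_zero hh fun k l => ?_
  have := H k l
  simp only [shiftPhase, mul_assoc, integral_const_mul] at this
  simpa only [mul_assoc] using (mul_eq_zero.1 this).resolve_left (Complex.exp_ne_zero _)

theorem fiberMap_add {n : ℕ} (f g : L2Phase n) :
    ∀ᵐ p ∂torusMeasure₂ n, fiberMap (f + g) p = fiberMap f p + fiberMap g p := by
  simp only [fiberMap_eq_slice, ← weylZakIsometry_apply, map_add]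
  exact slice_add _ _

theorem fiberMap_smul {n : ℕ} (c : ℂ) (f : L2Phase n) :
    ∀ᵐ p ∂torusMeasure₂ n, fiberMap (c • f) p = c • fiberMap f p := by
  simp only [fiberMap_eq_slice, ← weylZakIsometry_apply, map_smul]
  exact slice_mul (fun _ => c) (Lp.coeFn_smul c _)

theorem fiberMap_twistedTranslate {n : ℕ} (k l : Fin n → ℤ) (f : L2Phase n) :
    ∀ᵐ p ∂torusMeasure₂ n, fiberMap (twistedTranslate k l f) p
      = shiftPhase k l p • fiberMap f p := by
  simp only [fiberMap_eq_slice, weylZak_twistedTranslate]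
  exact slice_mul (shiftPhase k l) (coeFn_weightedComp _ _ _ _ _)

theorem integrable_inner_fiberMap {n : ℕ} (f g : L2Phase n) :
    Integrable (fun p => inner ℂ (fiberMap f p) (fiberMap g p)) (torusMeasure₂ n) :=
  integrable_inner_slice _ _

theorem integral_inner_fiberMap {n : ℕ} (f g : L2Phase n) :
    ∫ p, inner ℂ (fiberMap f p) (fiberMap g p) ∂torusMeasure₂ n = inner ℂ f g :=
  (integral_inner_slice _ _).trans ((weylZakIsometry n).inner_map_map f g)

/-- The map `𝒥` is injective up to null sets. -/
theorem eq_of_fiberMap_ae_eq {n : ℕ} {f g : L2Phase n}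
    (h : ∀ᵐ p ∂torusMeasure₂ n, fiberMap f p = fiberMap g p) : f = g := by
  refine ext_inner_left ℂ fun v => ?_
  rw [← integral_inner_fiberMap, ← integral_inner_fiberMap]
  refine integral_congr_ae ?_
  filter_upwards [h] with p hp
  rw [hp]

theorem norm_twistedTranslate {n : ℕ} (k l : Fin n → ℤ) (f : L2Phase n) :
    ‖twistedTranslate k l f‖ = ‖f‖ := by
  have h : inner ℂ (twistedTranslate k l f) (twistedTranslate k l f) = inner ℂ f f := by
    rw [← integral_inner_fiberMap, ← integral_inner_fiberMap]
    refine integral_congr_ae ?_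
    filter_upwards [fiberMap_twistedTranslate k l f] with p hp
    simp only [hp, inner_self_eq_norm_sq_to_K, norm_smul, norm_shiftPhase, one_mul]
  rw [inner_self_eq_norm_sq_to_K, inner_self_eq_norm_sq_to_K] at h
  norm_cast at h
  exact (sq_eq_sq₀ (norm_nonneg _) (norm_nonneg _)).1 h

theorem inner_twistedTranslate {n : ℕ} (k l : Fin n → ℤ) (f g : L2Phase n) :
    inner ℂ (twistedTranslate k l f) (twistedTranslate k l g) = inner ℂ f g :=
  LinearIsometry.inner_map_map
    { (twistedTranslateL k l).toLinearMap with norm_map' := norm_twistedTranslate k l } f g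

/-- The characters cancel but the twists do not: `(-k)·(-l) = k·l`, so the twist is squared.
Integrality of `k·l` then makes the product one. -/
theorem shiftPhase_neg_mul {n : ℕ} (k l : Fin n → ℤ) (p : Torus n × Torus n) :
    shiftPhase k l p * shiftPhase (-k) (-l) p
      = Complex.exp (2 * Real.pi * Complex.I * (inner ℝ (latticeVec k) (latticeVec l) : ℝ)) := by
  have hneg : ∀ k : Fin n → ℤ, latticeVec (-k) = -latticeVec k := fun k => by
    ext i; simp [latticeVec]
  have h1 : ∀ (k : Fin n → ℤ) (x : Torus n),
      UnitAddTorus.mFourier k x * UnitAddTorus.mFourier (-k) x = 1 := fun k x => by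
    rw [← UnitAddTorus.mFourier_add, add_neg_cancel, UnitAddTorus.mFourier_zero,
      ContinuousMap.one_apply]
  have h2 : ∀ a b c d e : ℂ, b * d = 1 → c * e = 1 → a * (b * c) * (a * (d * e)) = a * a :=
    fun a b c d e hb hc => by linear_combination a * a * (c * e) * hb + a * a * hc
  rw [shiftPhase, shiftPhase, hneg, hneg, inner_neg_neg, h2 _ _ _ _ _ (h1 k p.1) (h1 l p.2),
    ← Complex.exp_add]
  congr 1
  ring

theorem twistedTranslate_twistedTranslate_neg {n : ℕ} (k l : Fin n → ℤ) (f : L2Phase n) :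
    twistedTranslate k l (twistedTranslate (-k) (-l) f) = f := by
  refine eq_of_fiberMap_ae_eq ?_
  filter_upwards [fiberMap_twistedTranslate k l (twistedTranslate (-k) (-l) f),
    fiberMap_twistedTranslate (-k) (-l) f] with p h1 h2
  rw [h1, h2, smul_smul, shiftPhase_neg_mul, exp_pi_I_inner_latticeVec, one_smul]

/-! ### Cutting off fibres inside `V` -/

open Classical in
/-- Cutting off the fibres of an element of a twisted shift-invariant space outside a measurable set
gives another element of the space. -/
theorem exists_fiberMap_eq_indicator {n : ℕ} {V : Submodule ℂ (L2Phase n)} [CompleteSpace V]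
    (hV : IsTwistedShiftInvariant V) (f : V) {E : Set (Torus n × Torus n)} (hE : MeasurableSet E) :
    ∃ g : V, ∀ᵐ p ∂torusMeasure₂ n,
      fiberMap (g : L2Phase n) p = E.indicator (fun p => fiberMap (f : L2Phase n) p) p := by
  let W : Submodule ℂ (Lp ℂ 2 (zakMeasure n)) := V.map (weylZakIsometry n).toLinearMap
  have hWc : IsComplete (W : Set (Lp ℂ 2 (zakMeasure n))) := by
    have hVc : IsComplete (V : Set (L2Phase n)) := completeSpace_coe_iff_isComplete.1 inferInstance
    exact (isComplete_image_iff (weylZakIsometry n).isometry.isUniformInducing).2 hVc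
  have : CompleteSpace W := completeSpace_coe_iff_isComplete.2 hWc
  let F := weylZak (f : L2Phase n)
  have hFE : MemLp ((Prod.fst ⁻¹' E : Set ((Torus n × Torus n) × EucSp n)).indicator F) 2
      (zakMeasure n) := (Lp.memLp F).indicator (measurable_fst hE)
  have hG : ∀ᵐ p ∂torusMeasure₂ n, slice (hFE.toLp _) p
      = (E.indicator (fun _ => (1 : ℂ)) p) • slice F p := by
    refine slice_mul (E.indicator fun _ => (1 : ℂ)) ?_
    filter_upwards [hFE.coeFn_toLp] with w hw
    rw [hw]
    by_cases hp : w.1 ∈ E <;> simp [Set.indicator, hp]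
  -- The image `W` of `V` is complete, so membership may be tested against the vectors orthogonal to
  -- `W`.
  have hmem : hFE.toLp _ ∈ W := by
    rw [← Submodule.orthogonal_orthogonal W, Submodule.mem_orthogonal]
    intro H hH
    -- Orthogonality to all translates of `f` says that every Fourier coefficient of the fibrewise
    -- inner product vanishes. It is therefore zero pointwise, and stays zero after the cut-off.
    have hz : ∀ᵐ p ∂torusMeasure₂ n, inner ℂ (slice H p) (slice F p) = 0 := by
      refine ae_eq_zero_of_integral_shiftPhase_mul (integrable_inner_slice H F) fun k l => ?_
      have h0 : inner ℂ H (weylZak (twistedTranslate k l (f : L2Phase n))) = 0 :=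
        (Submodule.mem_orthogonal' W H).1 hH _ ⟨_, hV k l f f.2, rfl⟩
      rw [← h0, ← integral_inner_slice]
      refine integral_congr_ae ?_
      filter_upwards [fiberMap_twistedTranslate k l (f : L2Phase n)] with p hp
      rw [← fiberMap_eq_slice (twistedTranslate k l (f : L2Phase n)), hp, inner_smul_right]
      rfl
    rw [← integral_inner_slice]
    refine (integral_congr_ae ?_).trans (integral_zero _ _)
    filter_upwards [hG, hz] with p h1 h2
    rw [h1, inner_smul_right, h2, mul_zero]
  obtain ⟨g, hgV, hg⟩ := hmem
  refine ⟨⟨g, hgV⟩, ?_⟩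
  have hg' : weylZak g = hFE.toLp _ := hg
  filter_upwards [hG] with p hp
  rw [fiberMap_eq_slice]
  rw [hg', hp]
  by_cases hpE : p ∈ E <;> simp [Set.indicator, hpE, F, fiberMap_eq_slice]

/-! ### A countable fibrewise dense family -/

/-- Finite combinations of a sequence with coefficients in a countable dense set of scalars. -/
noncomputable def listComb {E : Type*} [AddCommGroup E] [Module ℂ E] (v : ℕ → E)
    (L : List (ℕ × ℕ)) : E :=
  (L.map fun q => TopologicalSpace.denseSeq ℂ q.1 • v q.2).sum

theorem listComb_append {E : Type*} [AddCommGroup E] [Module ℂ E] (v : ℕ → E)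
    (L L' : List (ℕ × ℕ)) : listComb v (L ++ L') = listComb v L + listComb v L' := by
  simp [listComb]

theorem listComb_mem_span {E : Type*} [AddCommGroup E] [Module ℂ E] (v : ℕ → E)
    (L : List (ℕ × ℕ)) : listComb v L ∈ Submodule.span ℂ (Set.range v) := by
  refine list_sum_mem fun x hx => ?_
  obtain ⟨q, -, rfl⟩ := List.mem_map.1 hx
  exact Submodule.smul_mem _ _ (Submodule.subset_span ⟨q.2, rfl⟩)

theorem span_le_closure_range_listComb {E : Type*} [NormedAddCommGroup E] [NormedSpace ℂ E]
    (v : ℕ → E) :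
    (Submodule.span ℂ (Set.range v) : Set E) ⊆ closure (Set.range (listComb v)) := by
  intro x hx
  induction hx using Submodule.closure_induction with
  | zero => exact subset_closure ⟨[], rfl⟩
  | add x y _ _ hx hy =>
    refine map_mem_closure₂ continuous_add hx hy ?_
    rintro _ ⟨L, rfl⟩ _ ⟨L', rfl⟩
    exact ⟨L ++ L', listComb_append v L L'⟩
  | smul_mem c x hx =>
    obtain ⟨i, rfl⟩ := hx
    refine map_mem_closure (f := fun c : ℂ => c • v i) (by fun_prop)
      (TopologicalSpace.denseRange_denseSeq ℂ c) ?_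
    rintro _ ⟨j, rfl⟩
    exact ⟨[(j, i)], by simp [listComb]⟩

/-- `fiberMap` is linear only almost everywhere, with a null set depending on the combination.
Restricting to countably many combinations allows one null set for all of them. -/
theorem fiberMap_listComb {n : ℕ} {V : Submodule ℂ (L2Phase n)} (f : ℕ → V) (L : List (ℕ × ℕ)) :
    ∀ᵐ p ∂torusMeasure₂ n, fiberMap ((listComb f L : V) : L2Phase n) p
      = listComb (fun i => fiberMap (f i : L2Phase n) p) L := by
  induction L with
  | nil =>
    filter_upwards [fiberMap_smul 0 (0 : L2Phase n)] with p hp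
    simpa [listComb] using hp
  | cons q L ih =>
    filter_upwards [ih, fiberMap_smul (TopologicalSpace.denseSeq ℂ q.1) (f q.2 : L2Phase n),
      fiberMap_add (TopologicalSpace.denseSeq ℂ q.1 • (f q.2 : L2Phase n))
        ((listComb f L : V) : L2Phase n)] with p h1 h2 h3
    rw [h2, h1] at h3
    simpa [listComb] using h3

section

variable {n : ℕ} {V : Submodule ℂ (L2Phase n)} {J : Torus n × Torus n → Submodule ℂ (L2Fiber n)}

/-- A countable family in `V` is fibrewise dense in the range function. -/
theorem IsRangeFunction.exists_dense (hJ : IsRangeFunction V J) :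
    ∃ g : List (ℕ × ℕ) → V, ∀ᵐ p ∂torusMeasure₂ n,
      (∀ i, fiberMap (g i : L2Phase n) p ∈ J p) ∧
      Dense {a : J p | ∃ i, (a : L2Fiber n) = fiberMap (g i : L2Phase n) p} := by
  obtain ⟨f, -, hf⟩ := hJ
  refine ⟨listComb f, ?_⟩
  filter_upwards [hf, ae_all_iff.2 (fiberMap_listComb f)] with p hp hL
  have hmem : ∀ L, fiberMap ((listComb f L : V) : L2Phase n) p ∈ J p := fun L => by
    rw [hp, hL]
    exact Submodule.le_topologicalClosure _ (listComb_mem_span _ L)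
  refine ⟨hmem, ?_⟩
  rw [Subtype.dense_iff]
  intro x hx
  rw [hp] at hx
  refine closure_mono ?_ (closure_minimal (span_le_closure_range_listComb _) isClosed_closure hx)
  rintro _ ⟨L, rfl⟩
  exact ⟨⟨_, hmem L⟩, ⟨L, rfl⟩, hL L⟩

/-! ### Calculus of operators acting fibrewise -/

/-- `Q` is a field of operators on the fibres of `J` through which `U` acts. -/
def Implements (V : Submodule ℂ (L2Phase n)) (J : Torus n × Torus n → Submodule ℂ (L2Fiber n))
    (U : V →L[ℂ] V) (Q : ∀ p, J p →L[ℂ] J p) : Prop :=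
  ∀ f : V, ∀ᵐ p ∂torusMeasure₂ n, ∃ h : fiberMap (f : L2Phase n) p ∈ J p,
    fiberMap (U f : L2Phase n) p = Q p ⟨fiberMap (f : L2Phase n) p, h⟩

namespace Implements

variable {U U' : V →L[ℂ] V} {Q Q' : ∀ p, J p →L[ℂ] J p}

theorem smul (h : Implements V J U Q) (c : ℂ) : Implements V J (c • U) (fun p => c • Q p) := by
  intro f
  filter_upwards [h f, fiberMap_smul c (U f : L2Phase n)] with p ⟨hp, e⟩ h2
  exact ⟨hp, h2.trans (by rw [e]; rfl)⟩

theorem add (h : Implements V J U Q) (h' : Implements V J U' Q') :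
    Implements V J (U + U') (fun p => Q p + Q' p) := by
  intro f
  filter_upwards [h f, h' f, fiberMap_add (U f : L2Phase n) (U' f)] with p ⟨hp, e⟩ ⟨_, e'⟩ h2
  exact ⟨hp, h2.trans (by rw [e, e']; rfl)⟩

/-- The given `Q` serves only to supply that the fibres of `V` lie in `J p`. -/
theorem one (h : Implements V J U Q) : Implements V J 1 (fun _ => 1) := by
  intro f
  filter_upwards [h f] with p ⟨hp, _⟩
  exact ⟨hp, rfl⟩

theorem mul (h : Implements V J U Q) (h' : Implements V J U' Q') :
    Implements V J (U * U') (fun p => Q p * Q' p) := by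
  intro f
  filter_upwards [h' f, h (U' f)] with p ⟨hp, e⟩ ⟨hp', e'⟩
  refine ⟨hp, e'.trans ?_⟩
  rw [mul_apply_eq_comp]
  congr 2
  exact Subtype.ext e

/-- Off one null set both fields are prescribed on the countable dense family, and continuity does
the rest. -/
theorem ae_eq (hJ : IsRangeFunction V J) (h : Implements V J U Q) (h' : Implements V J U Q') :
    ∀ᵐ p ∂torusMeasure₂ n, Q p = Q' p := by
  obtain ⟨g, hg⟩ := hJ.exists_dense
  filter_upwards [hg, ae_all_iff.2 fun i => h (g i), ae_all_iff.2 fun i => h' (g i)]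
    with p ⟨_, hd⟩ h1 h2
  refine ContinuousLinearMap.coeFn_injective
    (Continuous.ext_on hd (Q p).continuous (Q' p).continuous ?_)
  rintro a ⟨i, ha⟩
  obtain ⟨hm, e1⟩ := h1 i
  obtain ⟨_, e2⟩ := h2 i
  obtain rfl : a = ⟨_, hm⟩ := Subtype.ext ha
  exact Subtype.ext (e1.symm.trans e2)

theorem eq_iff (hJ : IsRangeFunction V J) (h : Implements V J U Q) (h' : Implements V J U' Q') :
    U = U' ↔ ∀ᵐ p ∂torusMeasure₂ n, Q p = Q' p := by
  refine ⟨fun e => ae_eq hJ h (e ▸ h'), fun e => ?_⟩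
  refine ContinuousLinearMap.ext fun f => Subtype.ext (eq_of_fiberMap_ae_eq ?_)
  filter_upwards [e, h f, h' f] with p he ⟨hp, e1⟩ ⟨_, e2⟩
  rw [e1, e2, he]

theorem inner_apply (h : Implements V J U Q) (f g : V) :
    ∀ᵐ p ∂torusMeasure₂ n, ∃ (hf : fiberMap (f : L2Phase n) p ∈ J p)
      (hg : fiberMap (g : L2Phase n) p ∈ J p),
      inner ℂ (fiberMap (U f : L2Phase n) p) (fiberMap (g : L2Phase n) p)
        = inner ℂ (Q p ⟨_, hf⟩) (⟨_, hg⟩ : J p) := by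
  filter_upwards [h f, h g] with p ⟨hf, e⟩ ⟨hg, _⟩
  exact ⟨hf, hg, by rw [e]; rfl⟩

theorem reApplyInnerSelf_nonneg [CompleteSpace V] (hV : IsTwistedShiftInvariant V)
    (hJ : IsRangeFunction V J)
    (h : Implements V J U Q) (hpos : ∀ f, 0 ≤ U.reApplyInnerSelf f) :
    ∀ᵐ p ∂torusMeasure₂ n, ∀ a, 0 ≤ (Q p).reApplyInnerSelf a := by
  have key : ∀ f : V, ∀ᵐ p ∂torusMeasure₂ n,
      0 ≤ (inner ℂ (fiberMap (U f : L2Phase n) p) (fiberMap (f : L2Phase n) p)).re := by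
    intro f
    refine ae_nonneg_of_forall_setIntegral_nonneg (integrable_inner_fiberMap _ _).re
      fun E hE _ => ?_
    -- Positivity of `U` at the cut-off `g` is the required integral over `E`: `Q` acts within
    -- fibres, so the integrand for `g` is that for `f` times the indicator of `E`.
    obtain ⟨g, hg⟩ := exists_fiberMap_eq_indicator hV f hE
    have h1 : 0 ≤ (inner ℂ (U g : L2Phase n) (g : L2Phase n)).re := hpos g
    rw [← integral_inner_fiberMap] at h1
    have h2 : (∫ p, inner ℂ (fiberMap (U g : L2Phase n) p) (fiberMap (g : L2Phase n) p)
        ∂torusMeasure₂ n).re = _ := (integral_re (integrable_inner_fiberMap _ _)).symm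
    rw [h2] at h1
    refine h1.trans_eq ?_
    rw [← integral_indicator hE]
    refine integral_congr_ae ?_
    filter_upwards [hg, h f, h g] with p hp ⟨hf, e⟩ ⟨hgm, e'⟩
    by_cases hpE : p ∈ E
    · rw [Set.indicator_of_mem hpE] at hp ⊢
      simp only [e, e', hp]
      rfl
    · rw [Set.indicator_of_notMem hpE] at hp ⊢
      simp [hp]
  obtain ⟨g, hg⟩ := hJ.exists_dense
  filter_upwards [hg, ae_all_iff.2 fun i => key (g i), ae_all_iff.2 fun i => h (g i)]
    with p ⟨_, hd⟩ hk hi a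
  have hcl : IsClosed {a : J p | 0 ≤ (Q p).reApplyInnerSelf a} :=
    isClosed_le continuous_const (Q p).reApplyInnerSelf_continuous
  refine hcl.closure_subset_iff.2 ?_ (hd a)
  rintro a ⟨i, ha⟩
  obtain ⟨hm, e⟩ := hi i
  obtain rfl : a = ⟨_, hm⟩ := Subtype.ext ha
  have := hk i
  rw [e] at this
  exact this

variable [CompleteSpace V] [∀ p, CompleteSpace (J p)]

theorem adjoint (hV : IsTwistedShiftInvariant V) (hJ : IsRangeFunction V J)
    (hU : IsTwistedShiftPreserving V U) (h : Implements V J U Q) :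
    Implements V J (ContinuousLinearMap.adjoint U)
      (fun p => ContinuousLinearMap.adjoint (Q p)) := by
  intro f
  set f' := ContinuousLinearMap.adjoint U f with hf'
  obtain ⟨g, hg⟩ := hJ.exists_dense
  -- The global adjoint identity, applied to all translates of `g`, gives equal Fourier coefficients
  -- on both sides, since `U` commutes with the translations. Hence the identity holds fibre by
  -- fibre.
  have key : ∀ g : V, ∀ᵐ p ∂torusMeasure₂ n,
      inner ℂ (fiberMap (f' : L2Phase n) p) (fiberMap (g : L2Phase n) p)
        - inner ℂ (fiberMap (f : L2Phase n) p) (fiberMap (U g : L2Phase n) p) = 0 := by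
    intro g
    refine ae_eq_zero_of_integral_shiftPhase_mul
      ((integrable_inner_fiberMap _ _).sub (integrable_inner_fiberMap _ _)) fun k l => ?_
    let Tg : V := ⟨twistedTranslate k l (g : L2Phase n), hV k l g g.2⟩
    have e0 : inner ℂ (f' : L2Phase n) (Tg : L2Phase n)
        = inner ℂ (f : L2Phase n) (U Tg : L2Phase n) :=
      ContinuousLinearMap.adjoint_inner_left U Tg f
    have e1 : inner ℂ (f' : L2Phase n) (Tg : L2Phase n)
        - inner ℂ (f : L2Phase n) (U Tg : L2Phase n) = 0 := sub_eq_zero.2 e0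
    rw [← integral_inner_fiberMap, ← integral_inner_fiberMap, ← integral_sub
      (integrable_inner_fiberMap _ _) (integrable_inner_fiberMap _ _)] at e1
    rw [← e1]
    refine integral_congr_ae ?_
    have hUT : (U Tg : L2Phase n) = twistedTranslate k l (U g : L2Phase n) := hU k l g Tg rfl
    rw [hUT]
    filter_upwards [fiberMap_twistedTranslate k l (g : L2Phase n),
      fiberMap_twistedTranslate k l (U g : L2Phase n)] with p h1 h2
    change _ = inner ℂ _ (fiberMap (twistedTranslate k l (g : L2Phase n)) p) - _
    rw [h1, h2, inner_smul_right, inner_smul_right, mul_sub]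
  filter_upwards [hg, ae_all_iff.2 fun i => key (g i), ae_all_iff.2 fun i => h (g i), h f, h f']
    with p ⟨_, hd⟩ hk hi ⟨hf, _⟩ ⟨hfm, _⟩
  refine ⟨hf, ?_⟩
  suffices hs : (⟨_, hfm⟩ : J p) = ContinuousLinearMap.adjoint (Q p) ⟨_, hf⟩ from
    congrArg Subtype.val hs
  refine ext_inner_right ℂ fun a => ?_
  rw [ContinuousLinearMap.adjoint_inner_left]
  refine congrFun (Continuous.ext_on hd (f := fun a => inner ℂ (⟨_, hfm⟩ : J p) a)
    (g := fun a => inner ℂ (⟨_, hf⟩ : J p) (Q p a))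
    (innerSL ℂ (⟨_, hfm⟩ : J p)).continuous
    ((innerSL ℂ (⟨_, hf⟩ : J p)).continuous.comp (Q p).continuous) ?_) a
  rintro a ⟨i, ha⟩
  obtain ⟨hm, e⟩ := hi i
  obtain rfl : a = ⟨_, hm⟩ := Subtype.ext ha
  have := sub_eq_zero.1 (hk i)
  rw [e] at this
  exact this

/-- Self-adjointness is an equation between operators and transfers by `eq_iff`. The quadratic form
of `U` is the integral of the forms of `Q p`, and the cut-off argument gives the converse. -/
theorem nonneg_iff (hV : IsTwistedShiftInvariant V) (hJ : IsRangeFunction V J)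
    (hU : IsTwistedShiftPreserving V U) (h : Implements V J U Q) :
    0 ≤ U ↔ ∀ᵐ p ∂torusMeasure₂ n, 0 ≤ Q p := by
  simp only [ContinuousLinearMap.nonneg_iff_isPositive, ContinuousLinearMap.isPositive_def',
    Filter.eventually_and]
  have hsa : IsSelfAdjoint U ↔ ∀ᵐ p ∂torusMeasure₂ n, IsSelfAdjoint (Q p) :=
    eq_iff hJ (adjoint hV hJ hU h) h
  refine and_congr hsa ⟨reApplyInnerSelf_nonneg hV hJ h, fun hp f => ?_⟩
  change 0 ≤ (inner ℂ (U f : L2Phase n) (f : L2Phase n)).re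
  rw [← integral_inner_fiberMap]
  have h2 : (∫ p, inner ℂ (fiberMap (U f : L2Phase n) p) (fiberMap (f : L2Phase n) p)
      ∂torusMeasure₂ n).re = _ := (integral_re (integrable_inner_fiberMap _ _)).symm
  rw [h2]
  refine integral_nonneg_of_ae ?_
  filter_upwards [hp, h f] with p hp ⟨hf, e⟩
  simp only [e]
  exact hp ⟨_, hf⟩

end Implements

end

/-! ### Spectral bounds as operator inequalities -/

/-- For self-adjoint `T` the bounds on the spectrum are the order bounds `A ≤ T ≤ B`. The
differences are written with sums and scalar multiples so that `Implements.add` and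
`Implements.smul` apply. -/
theorem isSelfAdjoint_and_spectrum_subset_iff {H : Type*} [NormedAddCommGroup H]
    [InnerProductSpace ℂ H] [CompleteSpace H] (T : H →L[ℂ] H) (A B : ℝ) :
    (IsSelfAdjoint T ∧ spectrum ℂ T ⊆ Complex.ofReal '' Set.Icc A B) ↔
      0 ≤ T + (-A : ℂ) • (1 : H →L[ℂ] H) ∧ 0 ≤ (B : ℂ) • (1 : H →L[ℂ] H) + (-1 : ℂ) • T := by
  have hc : ∀ r : ℝ, algebraMap ℝ (H →L[ℂ] H) r = (r : ℂ) • (1 : H →L[ℂ] H) := fun r => by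
    rw [Algebra.algebraMap_eq_smul_one]
    ext x
    simp
  have hA : T + (-A : ℂ) • (1 : H →L[ℂ] H) = T - algebraMap ℝ (H →L[ℂ] H) A := by
    rw [hc]; module
  have hB : (B : ℂ) • (1 : H →L[ℂ] H) + (-1 : ℂ) • T = algebraMap ℝ (H →L[ℂ] H) B - T := by
    rw [hc]; module
  rw [hA, hB, sub_nonneg, sub_nonneg]
  have key : ∀ hT : IsSelfAdjoint T, spectrum ℂ T ⊆ Complex.ofReal '' Set.Icc A B ↔
      algebraMap ℝ (H →L[ℂ] H) A ≤ T ∧ T ≤ algebraMap ℝ (H →L[ℂ] H) B := by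
    intro hT
    rw [algebraMap_le_iff_le_spectrum (a := T), le_algebraMap_iff_spectrum_le (a := T),
      ← hT.spectrumRestricts.algebraMap_image]
    refine (Set.image_subset_image_iff Complex.ofReal_injective).trans ?_
    exact ⟨fun h => ⟨fun x hx => (h hx).1, fun x hx => (h hx).2⟩,
      fun h x hx => ⟨h.1 x hx, h.2 x hx⟩⟩
  refine ⟨fun h => (key h.1).1 h.2, fun h => ?_⟩
  -- Nonnegative elements are self-adjoint, so one inequality already forces `T` to be so.
  have hT : IsSelfAdjoint T := by
    have h1 : IsSelfAdjoint (T - algebraMap ℝ (H →L[ℂ] H) A) :=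
      IsSelfAdjoint.of_nonneg (sub_nonneg.2 h.1)
    have h2 : IsSelfAdjoint (algebraMap ℝ (H →L[ℂ] H) A) :=
      (IsSelfAdjoint.all A).algebraMap _
    simpa using h1.add h2
  exact ⟨hT, (key hT).2 h⟩

theorem asEndomorphism_apply {H : Type*} [NormedAddCommGroup H] [InnerProductSpace ℂ H]
    {S : Submodule ℂ H} {T : S →L[ℂ] H} (h : ∀ a, T a ∈ S) (a : S) :
    (asEndomorphism S T a : H) = T a := by
  rw [asEndomorphism, dif_pos h]
  rfl

/-! ### Range operators and their adjoints -/

section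

variable {n : ℕ} {V : Submodule ℂ (L2Phase n)} {J : Torus n × Torus n → Submodule ℂ (L2Fiber n)}
  [∀ p, CompleteSpace (J p)] {U : V →L[ℂ] V} {R : ∀ p, J p →L[ℂ] L2Fiber n}

/-- On the dense family the value of `R p` is the fibre of `U (g i)`, again an element of `V`, so it
lies in `J p`. Since `J p` is closed, this extends to all of `J p`. -/
theorem IsRangeOperator.ae_mem (hJ : IsRangeFunction V J) (hR : IsRangeOperator V J U R) :
    ∀ᵐ p ∂torusMeasure₂ n, ∀ a : J p, R p a ∈ J p := by
  obtain ⟨g, hg⟩ := hJ.exists_dense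
  filter_upwards [hg, ae_all_iff.2 fun i => hR.apply_eq (g i),
    ae_all_iff.2 fun i => hR.apply_eq (U (g i))] with p ⟨_, hd⟩ h1 h2 a
  have hcl : IsClosed {a : J p | R p a ∈ J p} :=
    ((completeSpace_coe_iff_isComplete.1 inferInstance :
      IsComplete (J p : Set (L2Fiber n))).isClosed).preimage (R p).continuous
  refine hcl.closure_subset_iff.2 ?_ (hd a)
  rintro a ⟨i, ha⟩
  obtain ⟨hm, e⟩ := h1 i
  obtain ⟨hm', _⟩ := h2 i
  obtain rfl : a = ⟨_, hm⟩ := Subtype.ext ha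
  change R p _ ∈ J p
  rw [← e]
  exact hm'

theorem IsRangeOperator.implements (hJ : IsRangeFunction V J) (hR : IsRangeOperator V J U R) :
    Implements V J U (fun p => asEndomorphism (J p) (R p)) := by
  intro f
  filter_upwards [hR.apply_eq f, hR.ae_mem hJ] with p ⟨hf, e⟩ hm
  exact ⟨hf, by rw [asEndomorphism_apply hm, e]⟩

theorem IsRangeOperator.adjoint [CompleteSpace V] (hV : IsTwistedShiftInvariant V)
    (hJ : IsRangeFunction V J) (hU : IsTwistedShiftPreserving V U)
    (hR : IsRangeOperator V J U R) :
    IsRangeOperator V J (ContinuousLinearMap.adjoint U) (fun p =>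
      (J p).subtypeL ∘L ContinuousLinearMap.adjoint (asEndomorphism (J p) (R p))) where
  aemeasurable a b := by
    -- A matrix coefficient of the adjoint is the conjugate of the coefficient of `R p` with `a` and
    -- `b` exchanged.
    refine (Complex.continuous_conj.measurable.comp_aemeasurable (hR.aemeasurable b a)).congr ?_
    filter_upwards [hR.ae_mem hJ] with p hm
    set Q := asEndomorphism (J p) (R p) with hQ
    have e1 : inner ℂ a (R p ((J p).orthogonalProjectionOnto b))
        = inner ℂ ((J p).orthogonalProjectionOnto a) (Q ((J p).orthogonalProjectionOnto b)) := by
      rw [← asEndomorphism_apply hm]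
      exact (Submodule.inner_orthogonalProjectionOnto_eq_of_mem_right _ _).symm
    have e2 : inner ℂ b (((J p).subtypeL ∘L ContinuousLinearMap.adjoint Q)
          ((J p).orthogonalProjectionOnto a))
        = inner ℂ ((J p).orthogonalProjectionOnto b)
          (ContinuousLinearMap.adjoint Q ((J p).orthogonalProjectionOnto a)) :=
      (Submodule.inner_orthogonalProjectionOnto_eq_of_mem_right _ _).symm
    change starRingEnd ℂ (inner ℂ a (R p ((J p).orthogonalProjectionOnto b))) = _
    rw [e1, e2, inner_conj_symm, ContinuousLinearMap.adjoint_inner_right]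
  apply_eq f := (hR.implements hJ).adjoint hV hJ hU f

/-- Twisted translations are isometric and the one by `(-k, -l)` inverts the one by `(k, l)`, hence
is its adjoint. Commutation of `U` with the inverses passes to commutation of the adjoint with the
translations. -/
theorem IsTwistedShiftPreserving.adjoint [CompleteSpace V] (hV : IsTwistedShiftInvariant V)
    (hU : IsTwistedShiftPreserving V U) :
    IsTwistedShiftPreserving V (ContinuousLinearMap.adjoint U) := by
  intro k l f g hg
  have hT : ∀ u v : L2Phase n, inner ℂ (twistedTranslate k l u) v
      = inner ℂ u (twistedTranslate (-k) (-l) v) := fun u v => by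
    conv_lhs => rw [← twistedTranslate_twistedTranslate_neg k l v]
    exact inner_twistedTranslate k l _ _
  let w : V := ⟨twistedTranslate k l (ContinuousLinearMap.adjoint U f : V),
    hV k l _ (Subtype.prop _)⟩
  suffices hs : ContinuousLinearMap.adjoint U g = w from congrArg Subtype.val hs
  refine ext_inner_right ℂ fun v => ?_
  let v' : V := ⟨twistedTranslate (-k) (-l) (v : L2Phase n), hV _ _ _ v.2⟩
  have h1 : inner ℂ w v = inner ℂ (ContinuousLinearMap.adjoint U f) v' := hT _ _
  have h2 : inner ℂ g (U v) = inner ℂ f (U v') := by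
    change inner ℂ (g : L2Phase n) (U v : L2Phase n) = inner ℂ (f : L2Phase n) (U v' : L2Phase n)
    rw [hg, hT, hU (-k) (-l) v v' rfl]
  rw [h1, ContinuousLinearMap.adjoint_inner_left, ContinuousLinearMap.adjoint_inner_left, h2]

theorem IsTwistedShiftPreserving.add_smul_one (hU : IsTwistedShiftPreserving V U) (a b : ℂ) :
    IsTwistedShiftPreserving V (a • U + b • (1 : V →L[ℂ] V)) := by
  intro k l f g hg
  have h := hU k l f g hg
  change a • (U g : L2Phase n) + b • (g : L2Phase n)
    = twistedTranslateL k l (a • (U f : L2Phase n) + b • (f : L2Phase n))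
  rw [map_add, map_smul, map_smul, twistedTranslateL_apply, twistedTranslateL_apply, h, hg]

end

/-! ### The main theorem -/

theorem mainTheorem3 (n : ℕ) (V : Submodule ℂ (L2Phase n)) [CompleteSpace V]
    (hV : IsTwistedShiftInvariant V)
    (J : Torus n × Torus n → Submodule ℂ (L2Fiber n)) [∀ p, CompleteSpace (J p)]
    (hJ : IsRangeFunction V J)
    (U : V →L[ℂ] V) (hU : IsTwistedShiftPreserving V U)
    (R : ∀ p, J p →L[ℂ] L2Fiber n) (hR : IsRangeOperator V J U R) :
    -- almost every `R p` is an operator `J p → J p`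
    (∀ᵐ p ∂(torusMeasure₂ n), ∀ a : J p, R p a ∈ J p) ∧
    -- (i)
    (IsTwistedShiftPreserving V (ContinuousLinearMap.adjoint U) ∧
      IsRangeOperator V J (ContinuousLinearMap.adjoint U) (fun p =>
        (J p).subtypeL ∘L ContinuousLinearMap.adjoint (asEndomorphism (J p) (R p)))) ∧
    -- (ii)
    (∀ A B : ℝ, A ≤ B →
      ((IsSelfAdjoint U ∧ spectrum ℂ U ⊆ Complex.ofReal '' Set.Icc A B) ↔
        ∀ᵐ p ∂(torusMeasure₂ n), IsSelfAdjoint (asEndomorphism (J p) (R p)) ∧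
          spectrum ℂ (asEndomorphism (J p) (R p)) ⊆ Complex.ofReal '' Set.Icc A B)) ∧
    -- (iii)
    (U ∈ unitary (V →L[ℂ] V) ↔
      ∀ᵐ p ∂(torusMeasure₂ n),
        asEndomorphism (J p) (R p) ∈ unitary (J p →L[ℂ] J p)) := by
  have hI := hR.implements hJ
  have hIs := hI.adjoint hV hJ hU
  refine ⟨hR.ae_mem hJ, ⟨hU.adjoint hV, hR.adjoint hV hJ hU⟩, fun A B _ => ?_, ?_⟩
  · simp only [isSelfAdjoint_and_spectrum_subset_iff, Filter.eventually_and]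
    refine and_congr ?_ ?_
    -- The shifted operator must be shift preserving too, because transferring its positivity uses
    -- its adjoint.
    · have hP : IsTwistedShiftPreserving V (U + (-A : ℂ) • (1 : V →L[ℂ] V)) := by
        simpa using hU.add_smul_one 1 (-A : ℂ)
      exact (hI.add (hI.one.smul (-A : ℂ))).nonneg_iff hV hJ hP
    · have hP : IsTwistedShiftPreserving V ((B : ℂ) • (1 : V →L[ℂ] V) + (-1 : ℂ) • U) := by
        rw [add_comm]
        exact hU.add_smul_one (-1) (B : ℂ)
      exact ((hI.one.smul (B : ℂ)).add (hI.smul (-1))).nonneg_iff hV hJ hP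
  · simp only [Unitary.mem_iff, Filter.eventually_and]
    -- Unitarity is the pair `U* U = 1` and `U U* = 1`, each transferred as an equation between
    -- fields.
    exact and_congr ((hIs.mul hI).eq_iff hJ hI.one) ((hI.mul hIs).eq_iff hJ hI.one)
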